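/- Let $0<a<1/6$ and let $F:\mathbb{R}^2\to\mathbb{R}^2$, $F(x,y)=(x+2a\sin x+a\sin y,\; y+a\sin x+2a\sin y)$. A fixed point of $F$ is called a sink if all eigenvalues of the derivative of $F$ there have modulus $<1$, a repeller if they all have modulus $>1$, and a saddle if none has modulus $1$, at least one has modulus $<1$ and at least one has modulus $>1$. A heteroclinic curve from a fixed point $p$ to a fixed point $q$ is a set $C$ with $F(C)=C$ that is the image of a continuous injective map $\gamma:\mathbb{R}\to\mathbb{R}^2$ with $\gamma(t)\to p$ as $t\to-\infty$ and $\gamma(t)\to q$ as $t\to+\infty$, and such that every $z\in C$ has a full orbit $(X_n)_{n\in\mathbb{Z}}$ ($X_0=z$, $X_{n+1}=F(X_n)$) with $X_n\to p$ as $n\to-\infty$ and $X_n\to q$ as $n\to+\infty$. Then $(\pi,\pi)$ is a sink of $F$, and its basin of attraction $A=\{z: F^n(z)\to(\pi,\pi) \text{ as } n\to\infty\}$ is a bounded, simply connected open set containing $(\pi,\pi)$ with the following properties. 1. The points $(0,0)$, $(0,2\pi)$, $(2\pi,0)$, $(2\pi,2\pi)$ belong to $\partial A$ and are repellers. The points $(0,\pi)$,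 $(\pi,0)$, $(\pi,2\pi)$, $(2\pi,\pi)$ belong to $\partial A$ and are saddles in $\overline{A}$: each such $q$ is a saddle of $F$, and $\overline{A}\setminus\{q\}$ contains a point whose forward orbit converges to $q$ and a point with a full orbit that converges to $q$ in backward time. 2. $\partial A$ is the union of these eight points and of eight heteroclinic curves, one from each of the four repellers to each of the two adjacent saddles: from $(2\pi i,2\pi j)$ to $(\pi,2\pi j)$ and from $(2\pi i,2\pi j)$ to $(2\pi i,\pi)$, for $i,j\in\{0,1\}$. 3. $F(\partial A)=\partial A$. 4. The translates $\overline{A}^{\,l,k}=\overline{A}+(2\pi l,2\pi k)$, $(l,k)\in\mathbb{Z}^2$, tile the plane: they are closed sets with nonempty interior, their union is $\mathbb{R}^2$, and translates with different $(l,k)$ have disjoint interiors. Moreover $F(\overline{A}^{\,l,k})=\overline{A}^{\,l,k}$, and the translation by $(2\pi l,2\pi k)$ commutes with $F$, so that the dynamics on every tile is the same as on $\overline{A}$. -/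

import Mathlib

open Filter Topology

noncomputable section

namespace AlignedClocks

/-- The map `F` of the phase differences of three aligned clocks, with coupling parameter `a`. -/
def F (a : ℝ) (z : ℝ × ℝ) : ℝ × ℝ :=
  (z.1 + 2 * a * Real.sin z.1 + a * Real.sin z.2,
   z.2 + a * Real.sin z.1 + 2 * a * Real.sin z.2)

/-- The complex eigenvalues of the derivative of `f` at `p`. -/
def multipliers (f : ℝ × ℝ → ℝ × ℝ) (p : ℝ × ℝ) : Set ℂ :=
  {μ | μ ∈ ((fderiv ℝ f p : ℝ × ℝ →L[ℝ] ℝ × ℝ) : ℝ × ℝ →ₗ[ℝ] ℝ × ℝ).charpoly.aroots ℂ}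

/-- Hyperbolic sink: a fixed point all of whose multipliers have modulus less than one. -/
def IsSink (f : ℝ × ℝ → ℝ × ℝ) (p : ℝ × ℝ) : Prop :=
  f p = p ∧ DifferentiableAt ℝ f p ∧ ∀ μ ∈ multipliers f p, ‖μ‖ < 1

/-- Hyperbolic repeller: a fixed point all of whose multipliers have modulus greater than one. -/
def IsRepeller (f : ℝ × ℝ → ℝ × ℝ) (p : ℝ × ℝ) : Prop :=
  f p = p ∧ DifferentiableAt ℝ f p ∧ ∀ μ ∈ multipliers f p, 1 < ‖μ‖

/-- Hyperbolic saddle: a fixed point without multipliers of modulus one, having multipliers both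
inside and outside the unit circle. -/
def IsSaddle (f : ℝ × ℝ → ℝ × ℝ) (p : ℝ × ℝ) : Prop :=
  f p = p ∧ DifferentiableAt ℝ f p ∧ (∀ μ ∈ multipliers f p, ‖μ‖ ≠ 1) ∧
    (∃ μ ∈ multipliers f p, ‖μ‖ < 1) ∧ (∃ μ ∈ multipliers f p, 1 < ‖μ‖)

/-- A full (two-sided) orbit of `f`. -/
def IsOrbit (f : ℝ × ℝ → ℝ × ℝ) (X : ℤ → ℝ × ℝ) : Prop :=
  ∀ n : ℤ, X (n + 1) = f (X n)

/-- The points whose forward orbit converges to `p`: the stable set of `p`, which is the basin of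
attraction of `p` when `p` is a sink. -/
def basin (f : ℝ × ℝ → ℝ × ℝ) (p : ℝ × ℝ) : Set (ℝ × ℝ) :=
  {z | Tendsto (fun n : ℕ => f^[n] z) atTop (𝓝 p)}

/-- The points that have a full orbit converging to `p` in backward time. -/
def unstableSet (f : ℝ × ℝ → ℝ × ℝ) (p : ℝ × ℝ) : Set (ℝ × ℝ) :=
  {z | ∃ X : ℤ → ℝ × ℝ, IsOrbit f X ∧ X 0 = z ∧ Tendsto X atBot (𝓝 p)}

/-- `p` is a repeller in `S`: a point of `S` that is a hyperbolic repeller. -/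
def IsRepellerIn (f : ℝ × ℝ → ℝ × ℝ) (S : Set (ℝ × ℝ)) (p : ℝ × ℝ) : Prop :=
  p ∈ S ∧ IsRepeller f p

/-- `p` is a saddle in `S`: a point of `S` that is a hyperbolic saddle and such that both the
attracting and the repelling behaviour at `p` are present inside `S`. -/
def IsSaddleIn (f : ℝ × ℝ → ℝ × ℝ) (S : Set (ℝ × ℝ)) (p : ℝ × ℝ) : Prop :=
  p ∈ S ∧ IsSaddle f p ∧ (∃ z ∈ S, z ≠ p ∧ z ∈ basin f p) ∧
    (∃ z ∈ S, z ≠ p ∧ z ∈ unstableSet f p)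

/-- `C` is a heteroclinic curve of `f` from `p` to `q`: an invariant open arc without
self-intersections whose two ends are `p` and `q`, all of whose points lie on full orbits that
converge to `p` in backward time and to `q` in forward time. -/
def IsHeteroclinicCurve (f : ℝ × ℝ → ℝ × ℝ) (p q : ℝ × ℝ) (C : Set (ℝ × ℝ)) : Prop :=
  (∃ γ : ℝ → ℝ × ℝ, Continuous γ ∧ Function.Injective γ ∧ Set.range γ = C ∧
    Tendsto γ atBot (𝓝 p) ∧ Tendsto γ atTop (𝓝 q)) ∧
  f '' C = C ∧
  ∀ z ∈ C, ∃ X : ℤ → ℝ × ℝ, IsOrbit f X ∧ X 0 = z ∧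
    Tendsto X atBot (𝓝 p) ∧ Tendsto X atTop (𝓝 q)

/-- The translation by `(2πl, 2πk)`. -/
def translation (l k : ℤ) (z : ℝ × ℝ) : ℝ × ℝ :=
  (z.1 + 2 * Real.pi * l, z.2 + 2 * Real.pi * k)

/-- A family of sets tiles the plane: the members are closed with nonempty interior, they cover
the plane, and members with different indices have disjoint interiors. -/
def IsTiling {ι : Type} (T : ι → Set (ℝ × ℝ)) : Prop :=
  (∀ i, IsClosed (T i) ∧ (interior (T i)).Nonempty) ∧ (⋃ i, T i) = Set.univ ∧
    ∀ i j, i ≠ j → Disjoint (interior (T i)) (interior (T j))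

/-- The four points `(0,0)`, `(0,2π)`, `(2π,0)`, `(2π,2π)`. -/
def corner (i j : Fin 2) : ℝ × ℝ := (2 * Real.pi * (i : ℕ), 2 * Real.pi * (j : ℕ))

/-- The two points `(π,0)`, `(π,2π)`. -/
def midH (j : Fin 2) : ℝ × ℝ := (Real.pi, 2 * Real.pi * (j : ℕ))

/-- The two points `(0,π)`, `(2π,π)`. -/
def midV (i : Fin 2) : ℝ × ℝ := (2 * Real.pi * (i : ℕ), Real.pi)

end AlignedClocks

end

open Filter Topology

noncomputable section

namespace AlignedClocks

open Real Set

/-! ### Iteration and limits -/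

section Iteration

variable {f : ℝ × ℝ → ℝ × ℝ} {p q z : ℝ × ℝ}

/-! In coordinates `u`, `v` along the eigenvectors of the coupling matrix, `F a` becomes `K (3 * a)
a`, that is, `(u, v) ↦ (u + 3a cos u sin v, v + a sin u cos v)`. The lines `cos u = 0` and `cos v =
0` are invariant and cannot be crossed, so `square` is invariant. There both cosines are
nonnegative, hence `K` preserves the coordinatewise order. The fixed points in the square are the
origin (the saddle), two opposite corners that become sinks and two that become repellers. Orbits in
the positive or negative quadrant run monotonically to a sink. An orbit that enters neither stays in
one mixed quadrant (`no_jump`), is again monotone, and tends to the origin or sits at a repelling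
corner (`basin_cases`).

The boundary is found by order and connectedness instead of a stable manifold theorem. Two distinct
ordered points cannot both converge to the saddle, because it expands ordered differences
(`eq_of_le_of_mem_basin_zero`). Each vertical segment meets the stable set, because its ends lie in
two disjoint open basins (`exists_mem_basin_zero`). So the stable set is the graph of `-sep` for an
order isomorphism `sep`, and the basin of `(π/2, π/2)` in the square is the part strictly above it.

`K` commutes with the reflections of each coordinate in `π/2`, so folding the plane gives the whole
basin as `0 < sep (fold u) + fold v` (`mem_basin_iff`). This level function grows strictly along
segments towards the sink. Hence the basin is star-shaped, and its closure and frontier are given by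
`0 ≤` and `= 0`. The frontier consists of four copies of the graph, each cut by its saddle into two
heteroclinic arcs, all images of a single `arc` under symmetries of `F`.

`K` is a homeomorphism, being the identity plus a contraction, so backward orbits exist, and a
second connectedness argument yields a nontrivial point in the unstable set of the saddle
(`exists_unstable`). For the tiling, basins of distinct sinks are disjoint, and shifting a reduced
coordinate by `π` negates its fold, so one of two candidate tiles always contains a given point. -/

lemma apply_mem_basin_iff : f z ∈ basin f p ↔ z ∈ basin f p := by
  have h : (fun n : ℕ => f^[n] (f z)) = fun n : ℕ => f^[n + 1] z := by
    funext n; rw [Function.iterate_succ_apply]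
  change Tendsto _ _ _ ↔ Tendsto _ _ _
  rw [h]
  exact tendsto_add_atTop_iff_nat (f := fun n : ℕ => f^[n] z) 1

lemma iterate_mem_basin_iff (n : ℕ) : f^[n] z ∈ basin f p ↔ z ∈ basin f p := by
  induction n with
  | zero => rfl
  | succ n ih => rw [Function.iterate_succ_apply', apply_mem_basin_iff, ih]

lemma eq_of_mem_basin (hp : z ∈ basin f p) (hq : z ∈ basin f q) : p = q :=
  tendsto_nhds_unique hp hq

lemma mem_basin_of_fixed (h : f p = p) : p ∈ basin f p := by
  change Tendsto _ _ _
  simp only [Function.iterate_fixed h]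
  exact tendsto_const_nhds

lemma eq_of_fixed_of_mem_basin (h : f z = z) (hz : z ∈ basin f p) : z = p :=
  eq_of_mem_basin (mem_basin_of_fixed h) hz

/-- A continuous map commuting with the dynamics maps stable sets to stable sets. -/
lemma map_mem_basin {g σ : ℝ × ℝ → ℝ × ℝ} (hσ : Continuous σ) (h : Function.Semiconj σ f g)
    (hz : z ∈ basin f p) : σ z ∈ basin g (σ p) := by
  have h1 : (fun n : ℕ => g^[n] (σ z)) = fun n : ℕ => σ (f^[n] z) := by
    funext n; exact ((h.iterate_right n).eq z).symm
  change Tendsto _ _ _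
  rw [h1]
  exact (hσ.tendsto p).comp hz

lemma map_mem_unstableSet {g σ : ℝ × ℝ → ℝ × ℝ} (hσ : Continuous σ)
    (h : Function.Semiconj σ f g) (hz : z ∈ unstableSet f p) : σ z ∈ unstableSet g (σ p) := by
  obtain ⟨X, hX, h0, hb⟩ := hz
  refine ⟨σ ∘ X, fun n => ?_, by simp [h0], (hσ.tendsto p).comp hb⟩
  simp only [Function.comp_apply, hX n, h.eq]

/-- Heteroclinic curves are transported by continuous injections commuting with the dynamics. -/
lemma IsHeteroclinicCurve.image {g σ : ℝ × ℝ → ℝ × ℝ} {C : Set (ℝ × ℝ)} (hσ : Continuous σ)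
    (hi : Function.Injective σ) (h : Function.Semiconj σ f g) (hC : IsHeteroclinicCurve f p q C) :
    IsHeteroclinicCurve g (σ p) (σ q) (σ '' C) := by
  obtain ⟨⟨γ, hγ, hγi, hr, hb, ht⟩, hf, ho⟩ := hC
  refine ⟨⟨σ ∘ γ, hσ.comp hγ, hi.comp hγi, by rw [range_comp, hr], (hσ.tendsto p).comp hb,
    (hσ.tendsto q).comp ht⟩, ?_, ?_⟩
  · conv_rhs => rw [← hf]
    rw [← image_comp, ← image_comp, h.comp_eq]
  · rintro _ ⟨z, hz, rfl⟩
    obtain ⟨X, hX, h0, hb, ht⟩ := ho z hz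
    refine ⟨σ ∘ X, fun n => ?_, by simp [h0], (hσ.tendsto p).comp hb, (hσ.tendsto q).comp ht⟩
    simp only [Function.comp_apply, hX n, h.eq]

/-- A bounded monotone or antitone real sequence converges. -/
lemma exists_tendsto_of_monotone_or_antitone {x : ℕ → ℝ} {l r : ℝ}
    (h : Monotone x ∨ Antitone x) (hx : ∀ n, l ≤ x n ∧ x n ≤ r) :
    ∃ y, Tendsto x atTop (𝓝 y) ∧ l ≤ y ∧ y ≤ r := by
  have : ∃ y, Tendsto x atTop (𝓝 y) := by
    rcases h with h | h
    · exact ⟨_, tendsto_atTop_ciSup h ⟨r, by rintro _ ⟨n, rfl⟩; exact (hx n).2⟩⟩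
    · exact ⟨_, tendsto_atTop_ciInf h ⟨l, by rintro _ ⟨n, rfl⟩; exact (hx n).1⟩⟩
  obtain ⟨y, hy⟩ := this
  exact ⟨y, hy, ge_of_tendsto' hy fun n => (hx n).1, le_of_tendsto' hy fun n => (hx n).2⟩

/-- The square `[-π/2, π/2] × [-π/2, π/2]`. -/
def square : Set (ℝ × ℝ) :=
  {z | (-(π / 2) ≤ z.1 ∧ z.1 ≤ π / 2) ∧ (-(π / 2) ≤ z.2 ∧ z.2 ≤ π / 2)}

lemma exists_tendsto_of_mem_square {X : ℕ → ℝ × ℝ} (hX : ∀ n, X n ∈ square)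
    (h1 : Monotone (fun n => (X n).1) ∨ Antitone (fun n => (X n).1))
    (h2 : Monotone (fun n => (X n).2) ∨ Antitone (fun n => (X n).2)) :
    ∃ y ∈ square, Tendsto X atTop (𝓝 y) := by
  obtain ⟨y1, hy1, hl1⟩ := exists_tendsto_of_monotone_or_antitone h1 (fun n => (hX n).1)
  obtain ⟨y2, hy2, hl2⟩ := exists_tendsto_of_monotone_or_antitone h2 (fun n => (hX n).2)
  exact ⟨(y1, y2), ⟨hl1, hl2⟩, hy1.prodMk_nhds hy2⟩

/-- The limit of a forward orbit is a fixed point. -/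
lemma fixed_of_tendsto_forward (hf : Continuous f) {X : ℕ → ℝ × ℝ}
    (hX : ∀ n, X (n + 1) = f (X n)) (h : Tendsto X atTop (𝓝 p)) : f p = p := by
  refine tendsto_nhds_unique ((hf.tendsto p).comp h) ?_
  have : f ∘ X = fun n => X (n + 1) := by funext n; simp [hX]
  rw [this]
  exact (tendsto_add_atTop_iff_nat 1).2 h

/-- The limit of a backward orbit is a fixed point. -/
lemma fixed_of_tendsto_backward (hf : Continuous f) {X : ℕ → ℝ × ℝ}
    (hX : ∀ n, f (X (n + 1)) = X n) (h : Tendsto X atTop (𝓝 p)) : f p = p := by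
  refine tendsto_nhds_unique (((hf.tendsto p).comp ((tendsto_add_atTop_iff_nat 1).2 h))) ?_
  have : (f ∘ fun n => X (n + 1)) = X := by funext n; simp [hX]
  rw [this]
  exact h

end Iteration

/-! ### The cooperative normal form -/

/-- The map `F` in the coordinates `u = (x + y - π) / 2`, `v = (x - y + π) / 2`, where `b = 3a` and
`c = a`. -/
def K (b c : ℝ) (z : ℝ × ℝ) : ℝ × ℝ :=
  (z.1 + b * (cos z.1 * sin z.2), z.2 + c * (sin z.1 * cos z.2))

/-- The admissible coefficients of the normal form. -/
structure Admissible (b c : ℝ) : Prop where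
  b_pos : 0 < b
  b_lt : b < 1 / 2
  c_pos : 0 < c
  c_lt : c < 1 / 2

variable {b c : ℝ}

lemma Admissible.swap (h : Admissible b c) : Admissible c b := ⟨h.c_pos, h.c_lt, h.b_pos, h.b_lt⟩

lemma continuous_K : Continuous (K b c) := by unfold K; fun_prop

lemma K_swap (z : ℝ × ℝ) : (K b c z).swap = K c b z.swap := by
  ext <;> simp [K, mul_comm]

lemma K_neg (z : ℝ × ℝ) : K b c (-z) = -K b c z := by
  ext <;> simp [K] <;> ring

lemma semiconj_swap : Function.Semiconj Prod.swap (K b c) (K c b) := K_swap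

lemma semiconj_neg : Function.Semiconj (fun z => -z) (K b c) (K b c) := fun z => (K_neg z).symm

lemma K_zero : K b c 0 = 0 := by ext <;> simp [K]

/-- The cosine is 1-Lipschitz, so the perturbation cannot undo the growth of `x`. -/
lemma strictMono_add_mul_cos {t : ℝ} (ht : |t| < 1) : StrictMono fun x => x + t * cos x := by
  intro x y hxy
  have h1 := abs_cos_sub_cos_le y x
  rw [abs_of_pos (sub_pos.2 hxy)] at h1
  have h2 : |t * (cos y - cos x)| ≤ |t| * (y - x) := by
    rw [abs_mul]; exact mul_le_mul_of_nonneg_left h1 (abs_nonneg t)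
  have h3 := (abs_le.1 h2).1
  have h4 : |t| * (y - x) < y - x := by nlinarith
  change x + t * cos x < y + t * cos y
  nlinarith

lemma swap_mem_square {z : ℝ × ℝ} (hz : z ∈ square) : z.swap ∈ square := ⟨hz.2, hz.1⟩

lemma neg_mem_square {z : ℝ × ℝ} (hz : z ∈ square) : -z ∈ square := by
  obtain ⟨⟨h1, h2⟩, h3, h4⟩ := hz
  simp only [square, mem_ofPred_eq, Prod.fst_neg, Prod.snd_neg]
  refine ⟨⟨?_, ?_⟩, ?_, ?_⟩ <;> linarith

lemma fst_K_swap (z : ℝ × ℝ) : (K c b z.swap).1 = (K b c z).2 := by rw [← K_swap]; rfl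

lemma zero_mem_square : (0 : ℝ × ℝ) ∈ square := by
  have := pi_pos
  simp only [square, mem_ofPred_eq, Prod.fst_zero, Prod.snd_zero]
  refine ⟨⟨?_, ?_⟩, ?_, ?_⟩ <;> linarith

/-! ### Order-preserving dynamics on the square -/

namespace Admissible

variable (h : Admissible b c)
include h

lemma abs_mul_sin_lt (v : ℝ) : |b * sin v| < 1 := by
  rw [abs_mul, abs_of_pos h.b_pos]
  have := abs_sin_le_one v
  have := h.b_pos; have := h.b_lt
  nlinarith

lemma strictMono_fst (v : ℝ) : StrictMono fun u => (K b c (u, v)).1 := by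
  have := strictMono_add_mul_cos (h.abs_mul_sin_lt v)
  intro x y hxy
  have h1 := this hxy
  simp only [K] at h1 ⊢
  nlinarith

lemma strictMono_snd (u : ℝ) : StrictMono fun v => (K b c (u, v)).2 := by
  intro x y hxy
  have h1 := h.swap.strictMono_fst u hxy
  simp only [K] at h1 ⊢
  nlinarith

/-- The line `u = k` is invariant when `cos k = 0`, and each horizontal section of the first
coordinate is strictly increasing, so no orbit crosses this line in either time direction. -/
lemma fst_lt_iff {k : ℝ} (hk : cos k = 0) (z : ℝ × ℝ) : (K b c z).1 < k ↔ z.1 < k := by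
  have := (h.strictMono_fst z.2).lt_iff_lt (a := z.1) (b := k)
  simpa [K, hk] using this

lemma lt_fst_iff {k : ℝ} (hk : cos k = 0) (z : ℝ × ℝ) : k < (K b c z).1 ↔ k < z.1 := by
  have := (h.strictMono_fst z.2).lt_iff_lt (a := k) (b := z.1)
  simpa [K, hk] using this

lemma snd_lt_iff {k : ℝ} (hk : cos k = 0) (z : ℝ × ℝ) : (K b c z).2 < k ↔ z.2 < k := by
  have := (h.strictMono_snd z.1).lt_iff_lt (a := z.2) (b := k)
  simpa [K, hk] using this

lemma lt_snd_iff {k : ℝ} (hk : cos k = 0) (z : ℝ × ℝ) : k < (K b c z).2 ↔ k < z.2 := by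
  have := (h.strictMono_snd z.1).lt_iff_lt (a := k) (b := z.2)
  simpa [K, hk] using this

lemma K_mem_square_iff {z : ℝ × ℝ} : K b c z ∈ square ↔ z ∈ square := by
  have hk : cos (-(π / 2)) = 0 := by simp
  simp only [square, mem_ofPred_eq, ← not_lt, h.fst_lt_iff hk, h.lt_fst_iff cos_pi_div_two,
    h.snd_lt_iff hk, h.lt_snd_iff cos_pi_div_two]

lemma iterate_mem_square {z : ℝ × ℝ} (hz : z ∈ square) (n : ℕ) : (K b c)^[n] z ∈ square := by
  induction n with
  | zero => exact hz
  | succ n ih => rw [Function.iterate_succ_apply', h.K_mem_square_iff]; exact ih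

/-- Each coordinate increases in its own variable by `strictMono_fst` and `strictMono_snd`. It
increases in the other one because the cosine factor is nonnegative and the sine is increasing on
`[-π/2, π/2]`. The two variables are moved one after the other. -/
lemma K_le_K {z w : ℝ × ℝ} (hz : z ∈ square) (hw : w ∈ square) (hzw : z ≤ w) :
    K b c z ≤ K b c w := by
  obtain ⟨z1, z2⟩ := z
  obtain ⟨w1, w2⟩ := w
  simp only [square, mem_ofPred_eq] at hz hw
  obtain ⟨h1, h2⟩ := hzw
  simp only at h1 h2
  have hb := h.b_pos
  have hc := h.c_pos
  constructor
  · refine ((h.strictMono_fst z2).monotone h1).trans ?_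
    have e1 : 0 ≤ cos w1 := cos_nonneg_of_mem_Icc ⟨hw.1.1, hw.1.2⟩
    have e2 : sin z2 ≤ sin w2 := sin_le_sin_of_le_of_le_pi_div_two hz.2.1 hw.2.2 h2
    simp only [K]
    gcongr
  · refine ((h.strictMono_snd z1).monotone h2).trans ?_
    have e1 : 0 ≤ cos w2 := cos_nonneg_of_mem_Icc ⟨hw.2.1, hw.2.2⟩
    have e2 : sin z1 ≤ sin w1 := sin_le_sin_of_le_of_le_pi_div_two hz.1.1 hw.1.2 h1
    simp only [K]
    gcongr

lemma iterate_le_iterate {z w : ℝ × ℝ} (hz : z ∈ square) (hw : w ∈ square) (hzw : z ≤ w) (n : ℕ) :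
    (K b c)^[n] z ≤ (K b c)^[n] w := by
  induction n with
  | zero => exact hzw
  | succ n ih =>
    rw [Function.iterate_succ_apply', Function.iterate_succ_apply']
    exact h.K_le_K (h.iterate_mem_square hz n) (h.iterate_mem_square hw n) ih

/-- The fixed points in the square. -/
lemma fixed_cases {z : ℝ × ℝ} (hz : z ∈ square) (hf : K b c z = z) :
    z = 0 ∨ (z.1 = π / 2 ∨ z.1 = -(π / 2)) ∧ (z.2 = π / 2 ∨ z.2 = -(π / 2)) := by
  obtain ⟨u, v⟩ := z
  simp only [square, mem_ofPred_eq] at hz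
  have hpi := pi_pos
  have e1 : cos u * sin v = 0 := by
    have := congrArg Prod.fst hf
    simpa [K, h.b_pos.ne'] using this
  have e2 : sin u * cos v = 0 := by
    have := congrArg Prod.snd hf
    simpa [K, h.c_pos.ne'] using this
  have hc : ∀ x : ℝ, -(π / 2) ≤ x ∧ x ≤ π / 2 → cos x = 0 → x = π / 2 ∨ x = -(π / 2) := by
    intro x hx h0
    by_contra hcon
    push Not at hcon
    exact (cos_pos_of_mem_Ioo ⟨lt_of_le_of_ne hx.1 (Ne.symm hcon.2),
      lt_of_le_of_ne hx.2 hcon.1⟩).ne' h0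
  have hs : ∀ x : ℝ, -(π / 2) ≤ x ∧ x ≤ π / 2 → sin x = 0 → x = 0 := by
    intro x hx h0
    exact (sin_eq_zero_iff_of_lt_of_lt (by linarith) (by linarith)).1 h0
  rcases mul_eq_zero.1 e1 with e1 | e1
  · rcases mul_eq_zero.1 e2 with e2 | e2
    · have := sin_sq_add_cos_sq u; simp [e1, e2] at this
    · exact Or.inr ⟨hc u hz.1 e1, hc v hz.2 e2⟩
  · rcases mul_eq_zero.1 e2 with e2 | e2
    · left; rw [hs u hz.1 e2, hs v hz.2 e1]; rfl
    · have := sin_sq_add_cos_sq v; simp [e1, e2] at this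

/-- The sign of the increment of one coordinate is the sign of the other coordinate. With its three
companions this makes orbits monotone in each quadrant. -/
lemma le_fst {z : ℝ × ℝ} (hz : z ∈ square) (h2 : 0 ≤ z.2) : z.1 ≤ (K b c z).1 := by
  have := pi_pos
  have e1 : 0 ≤ cos z.1 := cos_nonneg_of_mem_Icc ⟨hz.1.1, hz.1.2⟩
  have e2 : 0 ≤ sin z.2 := sin_nonneg_of_nonneg_of_le_pi h2 (by linarith [hz.2.2])
  have := mul_nonneg h.b_pos.le (mul_nonneg e1 e2)
  simp only [K]; linarith

lemma fst_le {z : ℝ × ℝ} (hz : z ∈ square) (h2 : z.2 ≤ 0) : (K b c z).1 ≤ z.1 := by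
  have := pi_pos
  have e1 : 0 ≤ cos z.1 := cos_nonneg_of_mem_Icc ⟨hz.1.1, hz.1.2⟩
  have e2 : sin z.2 ≤ 0 := sin_nonpos_of_nonpos_of_neg_pi_le h2 (by linarith [hz.2.1])
  have := mul_nonneg h.b_pos.le (mul_nonneg e1 (neg_nonneg.2 e2))
  simp only [K]; linarith

lemma le_snd {z : ℝ × ℝ} (hz : z ∈ square) (h1 : 0 ≤ z.1) : z.2 ≤ (K b c z).2 := by
  simpa [fst_K_swap] using h.swap.le_fst (swap_mem_square hz) h1

lemma snd_le {z : ℝ × ℝ} (hz : z ∈ square) (h1 : z.1 ≤ 0) : (K b c z).2 ≤ z.2 := by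
  simpa [fst_K_swap] using h.swap.fst_le (swap_mem_square hz) h1

/-- An orbit cannot jump from one mixed quadrant to the opposite one. -/
lemma no_jump {z : ℝ × ℝ} (hz : z ∈ square) (h1 : 0 ≤ z.1) (h2 : z.2 ≤ 0) :
    0 ≤ (K b c z).1 ∨ (K b c z).2 ≤ 0 := by
  have hpi := pi_pos
  have hb := h.b_pos
  have hb' := h.b_lt
  have hc := h.c_pos
  have hc' := h.c_lt
  obtain ⟨u, v⟩ := z
  simp only [square, mem_ofPred_eq] at hz h1 h2
  simp only [K]
  have cu : 0 ≤ cos u := cos_nonneg_of_mem_Icc ⟨hz.1.1, hz.1.2⟩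
  have cv : 0 ≤ cos v := cos_nonneg_of_mem_Icc ⟨hz.2.1, hz.2.2⟩
  have cu' := cos_le_one u
  have cv' := cos_le_one v
  have su : sin u ≤ u := sin_le h1
  have sv : -sin v ≤ -v := by rw [← sin_neg]; exact sin_le (by linarith)
  have su0 : 0 ≤ sin u := sin_nonneg_of_nonneg_of_le_pi h1 (by linarith)
  have sv0 : sin v ≤ 0 := sin_nonpos_of_nonpos_of_neg_pi_le h2 (by linarith)
  -- The coordinate of larger modulus keeps its sign: its increment is at most `b` or `c` times the
  -- smaller modulus, and both coefficients are below 1.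
  rcases le_total (-v) u with huv | huv
  · left
    have : cos u * (-sin v) ≤ u := by nlinarith
    nlinarith
  · right
    have : sin u * cos v ≤ -v := by nlinarith
    nlinarith

lemma no_jump' {z : ℝ × ℝ} (hz : z ∈ square) (h1 : z.1 ≤ 0) (h2 : 0 ≤ z.2) :
    (K b c z).1 ≤ 0 ∨ 0 ≤ (K b c z).2 := by
  have := h.no_jump (neg_mem_square hz) (by simpa using h1) (by simpa using h2)
  simpa [K_neg] using this

/-! ### Convergence of orbits in the square -/

lemma K_nonneg {z : ℝ × ℝ} (hz : z ∈ square) (h0 : 0 ≤ z) : 0 ≤ K b c z := by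
  simpa [K_zero] using h.K_le_K zero_mem_square hz h0

lemma K_nonpos {z : ℝ × ℝ} (hz : z ∈ square) (h0 : z ≤ 0) : K b c z ≤ 0 := by
  simpa [K_zero] using h.K_le_K hz zero_mem_square h0

/-- The positive quadrant is invariant and both coordinates increase there, so the orbit converges
to a fixed point above `z`. As `z` is not the origin, only the corner `(π/2, π/2)` is left. -/
lemma tendsto_top {z : ℝ × ℝ} (hz : z ∈ square) (h0 : 0 ≤ z) (hne : z ≠ 0) :
    z ∈ basin (K b c) (π / 2, π / 2) := by
  have hpi := pi_pos
  have hs : ∀ n : ℕ, (K b c)^[n] z ∈ square := h.iterate_mem_square hz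
  have hpos : ∀ n : ℕ, 0 ≤ (K b c)^[n] z := fun n => by
    simpa [Function.iterate_fixed K_zero] using h.iterate_le_iterate zero_mem_square hz h0 n
  have m1 : Monotone fun n : ℕ => ((K b c)^[n] z).1 := monotone_nat_of_le_succ fun n => by
    rw [Function.iterate_succ_apply']; exact h.le_fst (hs n) (hpos n).2
  have m2 : Monotone fun n : ℕ => ((K b c)^[n] z).2 := monotone_nat_of_le_succ fun n => by
    rw [Function.iterate_succ_apply']; exact h.le_snd (hs n) (hpos n).1
  obtain ⟨y, hy, hl⟩ := exists_tendsto_of_mem_square hs (.inl m1) (.inl m2)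
  have hf := fixed_of_tendsto_forward continuous_K
    (fun n => Function.iterate_succ_apply' (K b c) n z) hl
  have k1 : z.1 ≤ y.1 := m1.ge_of_tendsto ((continuous_fst.tendsto y).comp hl) 0
  have k2 : z.2 ≤ y.2 := m2.ge_of_tendsto ((continuous_snd.tendsto y).comp hl) 0
  have z1 : 0 ≤ z.1 := h0.1
  have z2 : 0 ≤ z.2 := h0.2
  have : y = (π / 2, π / 2) := by
    rcases h.fixed_cases hy hf with rfl | ⟨e1, e2⟩
    · exact absurd (Prod.ext (le_antisymm k1 z1) (le_antisymm k2 z2)) hne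
    · refine Prod.ext (e1.resolve_right fun e => ?_) (e2.resolve_right fun e => ?_) <;> linarith
  rw [this] at hl
  exact hl

lemma tendsto_bot {z : ℝ × ℝ} (hz : z ∈ square) (h0 : z ≤ 0) (hne : z ≠ 0) :
    z ∈ basin (K b c) (-(π / 2), -(π / 2)) := by
  have := map_mem_basin continuous_neg semiconj_neg
    (h.tendsto_top (neg_mem_square hz) (by simpa using h0) (by simpa using hne))
  simpa using this

/-- An orbit that stays in a mixed quadrant converges to the origin unless it starts at the
corner. -/
lemma tendsto_zero_of_mixed {z : ℝ × ℝ} (hz : z ∈ square)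
    (hm : ∀ n : ℕ, 0 ≤ ((K b c)^[n] z).1 ∧ ((K b c)^[n] z).2 ≤ 0) :
    z ∈ basin (K b c) 0 ∨ z = (π / 2, -(π / 2)) := by
  have hpi := pi_pos
  have hs : ∀ n : ℕ, (K b c)^[n] z ∈ square := h.iterate_mem_square hz
  have m1 : Antitone fun n : ℕ => ((K b c)^[n] z).1 := antitone_nat_of_succ_le fun n => by
    rw [Function.iterate_succ_apply']; exact h.fst_le (hs n) (hm n).2
  have m2 : Monotone fun n : ℕ => ((K b c)^[n] z).2 := monotone_nat_of_le_succ fun n => by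
    rw [Function.iterate_succ_apply']; exact h.le_snd (hs n) (hm n).1
  obtain ⟨y, hy, hl⟩ := exists_tendsto_of_mem_square hs (.inr m1) (.inl m2)
  have hf := fixed_of_tendsto_forward continuous_K
    (fun n => Function.iterate_succ_apply' (K b c) n z) hl
  have l1 : Tendsto (fun n : ℕ => ((K b c)^[n] z).1) atTop (𝓝 y.1) :=
    (continuous_fst.tendsto y).comp hl
  have l2 : Tendsto (fun n : ℕ => ((K b c)^[n] z).2) atTop (𝓝 y.2) :=
    (continuous_snd.tendsto y).comp hl
  have k1 : y.1 ≤ z.1 := m1.le_of_tendsto l1 0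
  have k2 : z.2 ≤ y.2 := m2.ge_of_tendsto l2 0
  have j1 : 0 ≤ y.1 := ge_of_tendsto' l1 fun n => (hm n).1
  have j2 : y.2 ≤ 0 := le_of_tendsto' l2 fun n => (hm n).2
  rcases h.fixed_cases hy hf with rfl | ⟨e1, e2⟩
  · exact .inl hl
  · right
    have e1 := e1.resolve_right fun e => by linarith
    have e2 := e2.resolve_left fun e => by linarith
    exact Prod.ext (le_antisymm hz.1.2 (by linarith)) (le_antisymm (by linarith) hz.2.1)

/-- Every orbit in the square converges to one of the five fixed points in it, to a corner of the
antidiagonal only if it starts there. -/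
lemma basin_cases {z : ℝ × ℝ} (hz : z ∈ square) :
    z ∈ basin (K b c) (π / 2, π / 2) ∨ z ∈ basin (K b c) (-(π / 2), -(π / 2)) ∨
      z ∈ basin (K b c) 0 ∨ z = (π / 2, -(π / 2)) ∨ z = (-(π / 2), π / 2) := by
  have hs : ∀ n : ℕ, (K b c)^[n] z ∈ square := h.iterate_mem_square hz
  by_cases hp : ∃ n : ℕ, 0 ≤ (K b c)^[n] z
  · obtain ⟨n, hn⟩ := hp
    by_cases h0 : (K b c)^[n] z = 0
    · have := mem_basin_of_fixed (K_zero (b := b) (c := c))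
      rw [← h0, iterate_mem_basin_iff, h0] at this
      exact .inr (.inr (.inl this))
    · exact .inl ((iterate_mem_basin_iff n).1 (h.tendsto_top (hs n) hn h0))
  by_cases hq : ∃ n : ℕ, (K b c)^[n] z ≤ 0
  · obtain ⟨n, hn⟩ := hq
    have h0 : (K b c)^[n] z ≠ 0 := fun h0 => hp ⟨n, h0.ge⟩
    exact .inr (.inl ((iterate_mem_basin_iff n).1 (h.tendsto_bot (hs n) hn h0)))
  push Not at hp hq
  have hp' : ∀ n : ℕ, ¬(0 ≤ ((K b c)^[n] z).1 ∧ 0 ≤ ((K b c)^[n] z).2) := fun n hn => hp n hn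
  have hq' : ∀ n : ℕ, ¬(((K b c)^[n] z).1 ≤ 0 ∧ ((K b c)^[n] z).2 ≤ 0) := fun n hn => hq n hn
  -- The orbit never meets the closed positive or negative quadrant, so every iterate lies in a
  -- mixed one, and `no_jump` keeps it in the same one.
  rcases le_total 0 z.1 with h1 | h1
  · have hm : ∀ n : ℕ, 0 ≤ ((K b c)^[n] z).1 ∧ ((K b c)^[n] z).2 ≤ 0 := by
      intro n
      induction n with
      | zero => exact ⟨h1, le_of_not_ge fun h2 => hp' 0 ⟨h1, h2⟩⟩
      | succ n ih =>
        have a1 := hp' (n + 1)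
        have a2 := hq' (n + 1)
        have a3 := h.no_jump (hs n) ih.1 ih.2
        rw [Function.iterate_succ_apply'] at *
        grind
    rcases h.tendsto_zero_of_mixed hz hm with h3 | h3 <;> tauto
  · have hm : ∀ n : ℕ, ((K b c)^[n] z).1 ≤ 0 ∧ 0 ≤ ((K b c)^[n] z).2 := by
      intro n
      induction n with
      | zero => exact ⟨h1, le_of_not_ge fun h2 => hq' 0 ⟨h1, h2⟩⟩
      | succ n ih =>
        have a1 := hp' (n + 1)
        have a2 := hq' (n + 1)
        have a3 := h.no_jump' (hs n) ih.1 ih.2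
        rw [Function.iterate_succ_apply'] at *
        grind
    have hn : ∀ n : ℕ, (K b c)^[n] (-z) = -(K b c)^[n] z := fun n =>
      ((semiconj_neg.iterate_right n).eq z).symm
    rcases h.tendsto_zero_of_mixed (neg_mem_square hz) (fun n => by
      rw [hn]; simpa using hm n) with h3 | h3
    · have := map_mem_basin continuous_neg semiconj_neg h3
      simp only [neg_neg, neg_zero] at this
      tauto
    · have : z = (-(π / 2), π / 2) := by rw [← neg_neg z, h3]; simp
      tauto

/-- The orbit of `w` is squeezed between that of `z` and the upper right corner. -/
lemma basin_top_upper {z w : ℝ × ℝ} (hz : z ∈ square) (hw : w ∈ square) (hzw : z ≤ w)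
    (ht : z ∈ basin (K b c) (π / 2, π / 2)) : w ∈ basin (K b c) (π / 2, π / 2) := by
  have h1 : Tendsto (fun n : ℕ => ((K b c)^[n] z).1) atTop (𝓝 (π / 2)) :=
    (continuous_fst.tendsto _).comp ht
  have h2 : Tendsto (fun n : ℕ => ((K b c)^[n] z).2) atTop (𝓝 (π / 2)) :=
    (continuous_snd.tendsto _).comp ht
  have hle := h.iterate_le_iterate hz hw hzw
  have hs := h.iterate_mem_square hw
  exact (tendsto_of_tendsto_of_tendsto_of_le_of_le h1 tendsto_const_nhds (fun n => (hle n).1)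
    (fun n => (hs n).1.2)).prodMk_nhds (tendsto_of_tendsto_of_tendsto_of_le_of_le h2
      tendsto_const_nhds (fun n => (hle n).2) (fun n => (hs n).2.2))

lemma basin_bot_lower {z w : ℝ × ℝ} (hz : z ∈ square) (hw : w ∈ square) (hzw : z ≤ w)
    (ht : w ∈ basin (K b c) (-(π / 2), -(π / 2))) : z ∈ basin (K b c) (-(π / 2), -(π / 2)) := by
  have h1 := map_mem_basin continuous_neg semiconj_neg ht
  simp only [Prod.neg_mk, neg_neg] at h1
  have h2 := map_mem_basin continuous_neg semiconj_neg
    (h.basin_top_upper (neg_mem_square hw) (neg_mem_square hz) (neg_le_neg hzw) h1)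
  simpa using h2

/-! ### Expansion of ordered differences near the saddle -/

lemma K_lt_K {z w : ℝ × ℝ} (hz : z ∈ square) (hw : w ∈ square) (hzw : z < w) :
    K b c z < K b c w := by
  refine lt_of_le_of_ne (h.K_le_K hz hw hzw.le) fun he => ?_
  have hle := hzw.le
  by_cases h1 : z.1 < w.1
  · have a1 := h.strictMono_fst z.2 h1
    have hm : (w.1, z.2) ∈ square := ⟨hw.1, hz.2⟩
    have a2 := (h.K_le_K hm hw ⟨le_rfl, hle.2⟩).1
    exact (a1.trans_le a2).ne (congrArg Prod.fst he)
  · have e1 : z.1 = w.1 := le_antisymm hle.1 (not_lt.1 h1)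
    have h2 : z.2 < w.2 := lt_of_le_of_ne hle.2 fun e2 => hzw.ne (Prod.ext e1 e2)
    have a1 := h.strictMono_snd z.1 h2
    have : (z.1, w.2) = w := by rw [e1]
    simp only [this] at a1
    exact a1.ne (congrArg Prod.snd he)

/-- Near the origin `K` is close to `(u + b v, v + c u)`. An ordered difference loses at most the
fraction `b * δ` of its own coordinate and gains at least `b / 4` times the other one. -/
lemma fst_sub_fst_ge {z w : ℝ × ℝ} {δ : ℝ} (hδ : δ ≤ 1) (hzw : z ≤ w)
    (hz1 : |z.1| ≤ δ) (hz2 : |z.2| ≤ δ) (hw1 : |w.1| ≤ δ) (hw2 : |w.2| ≤ δ) :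
    (w.1 - z.1) * (1 - b * δ) + b / 4 * (w.2 - z.2) ≤ (K b c w).1 - (K b c z).1 := by
  obtain ⟨u, v⟩ := z
  obtain ⟨u', v'⟩ := w
  obtain ⟨h1, h2⟩ := hzw
  simp only at *
  have hb := h.b_pos
  have key : ∀ x : ℝ, |x| ≤ 1 → 1 / 2 ≤ cos x := fun x hx => by
    have := one_sub_sq_div_two_le_cos (x := x)
    have : x ^ 2 ≤ 1 := by rw [← sq_abs]; nlinarith [abs_nonneg x]
    linarith
  -- The sine grows at rate at least 1/2 on `[-1, 1]`. Together with `cos u' ≥ 1/2` this gives the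
  -- factor 1/4.
  have hmono : MonotoneOn (fun x => sin x - x / 2) (Icc (-1) 1) := by
    refine monotoneOn_of_deriv_nonneg (convex_Icc _ _) (by fun_prop) (by fun_prop) ?_
    intro x hx
    rw [interior_Icc] at hx
    have hd : HasDerivAt (fun x => sin x - x / 2) (cos x - 1 / 2) x :=
      (hasDerivAt_sin x).sub ((hasDerivAt_id x).div_const 2)
    rw [hd.deriv]
    linarith [key x (abs_le.2 ⟨hx.1.le, hx.2.le⟩)]
  have hs := hmono (abs_le.1 (hz2.trans hδ)) (abs_le.1 (hw2.trans hδ)) h2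
  simp only at hs
  have hcos := key u' (hw1.trans hδ)
  have e1 : |(cos u' - cos u) * sin v| ≤ (u' - u) * δ := by
    rw [abs_mul]
    have a1 := abs_cos_sub_cos_le u' u
    rw [abs_of_nonneg (sub_nonneg.2 h1)] at a1
    have a2 : |sin v| ≤ δ := (abs_sin_le_abs).trans hz2
    exact mul_le_mul a1 a2 (abs_nonneg _) (sub_nonneg.2 h1)
  have e2 := (abs_le.1 e1).1
  have e3 : 1 / 4 * (v' - v) ≤ cos u' * (sin v' - sin v) := by nlinarith
  have e4 : b * (1 / 4 * (v' - v) - (u' - u) * δ) ≤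
      b * (cos u' * (sin v' - sin v) + (cos u' - cos u) * sin v) :=
    mul_le_mul_of_nonneg_left (by linarith) hb.le
  simp only [K]
  linarith

/-- The stable set of the saddle at the origin is an antichain in the square. -/
lemma eq_of_le_of_mem_basin_zero {z w : ℝ × ℝ} (hz : z ∈ square) (hw : w ∈ square) (hzw : z ≤ w)
    (hz0 : z ∈ basin (K b c) 0) (hw0 : w ∈ basin (K b c) 0) : z = w := by
  by_contra hne
  have hb := h.b_pos
  have hc := h.c_pos
  have hlt : ∀ n : ℕ, (K b c)^[n] z < (K b c)^[n] w := by
    intro n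
    induction n with
    | zero => exact lt_of_le_of_ne hzw hne
    | succ n ih =>
      rw [Function.iterate_succ_apply', Function.iterate_succ_apply']
      exact h.K_lt_K (h.iterate_mem_square hz n) (h.iterate_mem_square hw n) ih
  -- With this `δ`, the loss `b * δ` in the first coordinate is covered by the gain `c / 4` that it
  -- produces in the second, and conversely.
  obtain ⟨δ, hδ, hδ1, hδb, hδc⟩ : ∃ δ : ℝ, 0 < δ ∧ δ ≤ 1 ∧ b * δ ≤ c / 4 ∧ c * δ ≤ b / 4 := by
    refine ⟨min 1 (min (c / 4 / b) (b / 4 / c)), by positivity, min_le_left _ _, ?_, ?_⟩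
    · have : min 1 (min (c / 4 / b) (b / 4 / c)) ≤ c / 4 / b :=
        (min_le_right _ _).trans (min_le_left _ _)
      rw [le_div_iff₀ hb] at this; linarith
    · have : min 1 (min (c / 4 / b) (b / 4 / c)) ≤ b / 4 / c :=
        (min_le_right _ _).trans (min_le_right _ _)
      rw [le_div_iff₀ hc] at this; linarith
  have small : ∀ y : ℝ × ℝ, y ∈ basin (K b c) 0 →
      ∀ᶠ n : ℕ in atTop, |((K b c)^[n] y).1| ≤ δ ∧ |((K b c)^[n] y).2| ≤ δ := by
    intro y hy
    filter_upwards [hy.eventually (Metric.closedBall_mem_nhds 0 hδ)] with n hn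
    rw [dist_zero_right, Prod.norm_def, max_le_iff] at hn
    exact hn
  obtain ⟨N, hN⟩ := eventually_atTop.1 ((small z hz0).and (small w hw0))
  -- The sum of the coordinate gaps is positive and does not decrease once both orbits are within
  -- `δ` of the origin, which contradicts its convergence to zero.
  set d : ℕ → ℝ := fun n => (((K b c)^[n] w).1 - ((K b c)^[n] z).1) +
    (((K b c)^[n] w).2 - ((K b c)^[n] z).2) with hd
  have hmono : ∀ n, d N ≤ d (N + n) := by
    intro n
    induction n with
    | zero => rfl
    | succ n ih =>
      refine ih.trans ?_
      have hs := hN (N + n) (by omega)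
      have hle := (hlt (N + n)).le
      simp only [hd, ← add_assoc]
      rw [Function.iterate_succ_apply', Function.iterate_succ_apply']
      generalize (K b c)^[N + n] z = p at *
      generalize (K b c)^[N + n] w = q at *
      have e1 := h.fst_sub_fst_ge hδ1 hle hs.1.1 hs.1.2 hs.2.1 hs.2.2
      have e2 := h.swap.fst_sub_fst_ge (z := p.swap) (w := q.swap) hδ1 (Prod.swap_le_swap.2 hle)
        hs.1.2 hs.1.1 hs.2.2 hs.2.1
      simp only [fst_K_swap, Prod.fst_swap, Prod.snd_swap] at e2
      have h1 : 0 ≤ q.1 - p.1 := sub_nonneg.2 hle.1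
      have h2 : 0 ≤ q.2 - p.2 := sub_nonneg.2 hle.2
      have := mul_nonneg h1 (sub_nonneg.2 hδb)
      have := mul_nonneg h2 (sub_nonneg.2 hδc)
      nlinarith
  have hlim : Tendsto d atTop (𝓝 0) := by
    have h1 : ∀ y : ℝ × ℝ, y ∈ basin (K b c) 0 →
        Tendsto (fun n : ℕ => ((K b c)^[n] y).1) atTop (𝓝 0) := fun y hy =>
      (continuous_fst.tendsto (0 : ℝ × ℝ)).comp hy
    have h2 : ∀ y : ℝ × ℝ, y ∈ basin (K b c) 0 →
        Tendsto (fun n : ℕ => ((K b c)^[n] y).2) atTop (𝓝 0) := fun y hy =>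
      (continuous_snd.tendsto (0 : ℝ × ℝ)).comp hy
    simpa using ((h1 w hw0).sub (h1 z hz0)).add ((h2 w hw0).sub (h2 z hz0))
  have hpos : 0 < d N := by
    have hl := hlt N
    have h1 := hl.le.1
    have h2 := hl.le.2
    by_contra hcon
    simp only [hd] at hcon
    exact hl.ne (Prod.ext (by linarith) (by linarith))
  have : d N ≤ 0 := ge_of_tendsto ((tendsto_add_atTop_iff_nat N).2 hlim)
    (Eventually.of_forall fun n => by rw [add_comm]; exact hmono n)
  linarith

end Admissible

/-! ### Full orbits of homeomorphisms -/

/-- Through every point passes a full orbit of a homeomorphism. -/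
lemma exists_isOrbit (f : ℝ × ℝ ≃ₜ ℝ × ℝ) (z : ℝ × ℝ) :
    ∃ X : ℤ → ℝ × ℝ, IsOrbit f X ∧ X 0 = z ∧ (∀ n : ℕ, X n = f^[n] z) ∧
      ∀ n : ℕ, X (-n) = f.symm^[n] z := by
  let e : Equiv.Perm (ℝ × ℝ) := f.toEquiv
  refine ⟨fun n => (e ^ n) z, fun n => ?_, by simp, fun n => ?_, fun n => ?_⟩
  · simp only [add_comm n 1, zpow_add, zpow_one, Equiv.Perm.mul_apply]
    rfl
  · simp only [zpow_natCast, Equiv.Perm.coe_pow]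
    rfl
  · simp only [zpow_neg, zpow_natCast, ← inv_pow, Equiv.Perm.coe_pow]
    rfl

lemma tendsto_int_atTop {X : ℤ → ℝ × ℝ} {p : ℝ × ℝ}
    (h : Tendsto (fun n : ℕ => X n) atTop (𝓝 p)) : Tendsto X atTop (𝓝 p) := by
  rw [← Nat.map_cast_int_atTop]
  exact tendsto_map'_iff.2 h

lemma tendsto_int_atBot {X : ℤ → ℝ × ℝ} {p : ℝ × ℝ}
    (h : Tendsto (fun n : ℕ => X (-n)) atTop (𝓝 p)) : Tendsto X atBot (𝓝 p) := by
  have h1 : Tendsto (fun n : ℤ => X (-n)) atTop (𝓝 p) := tendsto_int_atTop h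
  simpa [Function.comp_def] using h1.comp tendsto_neg_atBot_atTop

lemma mem_unstableSet_of_tendsto {f : ℝ × ℝ ≃ₜ ℝ × ℝ} {z p : ℝ × ℝ}
    (h : Tendsto (fun n : ℕ => f.symm^[n] z) atTop (𝓝 p)) : z ∈ unstableSet f p := by
  obtain ⟨X, hX, h0, -, hb⟩ := exists_isOrbit f z
  exact ⟨X, hX, h0, tendsto_int_atBot (by simpa only [hb] using h)⟩

/-- The square centred at `(π/2, π/2)` with side `2π` is folded onto the square by this map in each
coordinate. -/
def fold (t : ℝ) : ℝ := π / 2 - |t - π / 2|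

lemma K_corner {z : ℝ × ℝ} (h1 : cos z.1 = 0) (h2 : cos z.2 = 0) : K b c z = z := by
  ext <;> simp [K, h1, h2]

/-- The vertical line is invariant and closed, so limits of its orbits lie on it. -/
lemma fst_eq_of_mem_basin {z p : ℝ × ℝ} {k : ℝ} (hk : cos k = 0) (hz : z.1 = k)
    (hp : z ∈ basin (K b c) p) : p.1 = k := by
  have hv : ∀ n : ℕ, ((K b c)^[n] z).1 = k := by
    intro n
    induction n with
    | zero => exact hz
    | succ n ih => rw [Function.iterate_succ_apply']; simp [K, ih, hk]
  have := (continuous_fst.tendsto p).comp hp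
  simp only [Function.comp_def, hv] at this
  exact tendsto_nhds_unique this tendsto_const_nhds

lemma continuous_fold : Continuous fold := by unfold fold; fun_prop

lemma fold_le (t : ℝ) : fold t ≤ π / 2 := by
  have := abs_nonneg (t - π / 2); unfold fold; linarith

lemma fold_of_le {t : ℝ} (ht : t ≤ π / 2) : fold t = t := by
  unfold fold; rw [abs_of_nonpos (by linarith)]; ring

lemma fold_of_ge {t : ℝ} (ht : π / 2 ≤ t) : fold t = π - t := by
  unfold fold; rw [abs_of_nonneg (by linarith)]; ring

lemma neg_pi_div_two_le_fold {t : ℝ} : -(π / 2) ≤ fold t ↔ -(π / 2) ≤ t ∧ t ≤ 3 * π / 2 := by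
  have hpi := pi_pos
  rcases le_total t (π / 2) with ht | ht
  · rw [fold_of_le ht]; constructor <;> intro <;> first | constructor | skip
    all_goals linarith
  · rw [fold_of_ge ht]; constructor <;> intro <;> first | constructor | skip
    all_goals linarith

/-! ### Invertibility of the normal form -/

namespace Admissible

variable (h : Admissible b c)
include h

lemma abs_fst_sub_le (z w : ℝ × ℝ) :
    |b * (cos z.1 * sin z.2) - b * (cos w.1 * sin w.2)| ≤ 2 * b * ‖z - w‖ := by
  have h1 : |z.1 - w.1| ≤ ‖z - w‖ := norm_fst_le (z - w)
  have h2 : |z.2 - w.2| ≤ ‖z - w‖ := norm_snd_le (z - w)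
  have e : b * (cos z.1 * sin z.2) - b * (cos w.1 * sin w.2) =
      b * ((cos z.1 - cos w.1) * sin z.2 + cos w.1 * (sin z.2 - sin w.2)) := by ring
  have i1 : |(cos z.1 - cos w.1) * sin z.2| ≤ ‖z - w‖ * 1 := by
    rw [abs_mul]
    exact mul_le_mul ((abs_cos_sub_cos_le _ _).trans h1) (abs_sin_le_one _) (abs_nonneg _)
      (norm_nonneg _)
  have i2 : |cos w.1 * (sin z.2 - sin w.2)| ≤ 1 * ‖z - w‖ := by
    rw [abs_mul]
    exact mul_le_mul (abs_cos_le_one _) ((abs_sin_sub_sin_le _ _).trans h2) (abs_nonneg _)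
      zero_le_one
  rw [e, abs_mul, abs_of_pos h.b_pos]
  have := abs_add_le ((cos z.1 - cos w.1) * sin z.2) (cos w.1 * (sin z.2 - sin w.2))
  have := mul_le_mul_of_nonneg_left (this.trans (add_le_add i1 i2)) h.b_pos.le
  linarith

/-- In the sup norm `K` differs from the identity by a map with Lipschitz constant `2 * max b c`.
The bound 1/2 on the coefficients makes this less than 1, which yields a global inverse. -/
lemma approximatesLinearOn : ApproximatesLinearOn (K b c)
    (ContinuousLinearEquiv.refl ℝ (ℝ × ℝ) : (ℝ × ℝ) →L[ℝ] (ℝ × ℝ)) univ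
    (2 * max b c).toNNReal := by
  intro z _ w _
  have hb := h.b_pos
  rw [coe_toNNReal _ (by positivity), Prod.norm_def]
  have n0 := norm_nonneg (z - w)
  have m1 := le_max_left b c
  have m2 := le_max_right b c
  have i1 := h.abs_fst_sub_le z w
  have i2 := h.swap.abs_fst_sub_le z.swap w.swap
  have ns : ‖z.swap - w.swap‖ = ‖z - w‖ := by
    rw [Prod.norm_def, Prod.norm_def, max_comm]; rfl
  rw [ns] at i2
  simp only [Prod.fst_swap, Prod.snd_swap] at i2
  refine max_le ?_ ?_
  · have e : (K b c z - K b c w - (z - w)).1 =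
        b * (cos z.1 * sin z.2) - b * (cos w.1 * sin w.2) := by simp [K]; ring
    exact (congrArg _ e).le.trans (i1.trans (by gcongr))
  · have e : (K b c z - K b c w - (z - w)).2 =
        c * (cos z.2 * sin z.1) - c * (cos w.2 * sin w.1) := by simp [K]; ring
    exact (congrArg _ e).le.trans (i2.trans (by gcongr))

lemma approximation_lt_one : (2 * max b c).toNNReal <
    ‖((ContinuousLinearEquiv.refl ℝ (ℝ × ℝ)).symm : (ℝ × ℝ) →L[ℝ] (ℝ × ℝ))‖₊⁻¹ := by
  have : max b c < 1 / 2 := max_lt h.b_lt h.c_lt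
  have hN : ‖((ContinuousLinearEquiv.refl ℝ (ℝ × ℝ)).symm : (ℝ × ℝ) →L[ℝ] (ℝ × ℝ))‖₊ = 1 :=
    NNReal.eq (ContinuousLinearMap.norm_id (𝕜 := ℝ) (E := ℝ × ℝ))
  rw [hN, inv_one, toNNReal_lt_one]
  linarith

/-- The normal form as a homeomorphism of the plane. -/
def homeo : ℝ × ℝ ≃ₜ ℝ × ℝ :=
  h.approximatesLinearOn.toHomeomorph _ (.inr h.approximation_lt_one)

lemma coe_homeo : ⇑h.homeo = K b c := rfl

lemma K_symm (z : ℝ × ℝ) : K b c (h.homeo.symm z) = z := h.homeo.apply_symm_apply z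

lemma K_symm_iterate (n : ℕ) (z : ℝ × ℝ) :
    K b c (h.homeo.symm^[n + 1] z) = h.homeo.symm^[n] z := by
  rw [Function.iterate_succ_apply', h.K_symm]

lemma symm_iterate_mem_square {z : ℝ × ℝ} (hz : z ∈ square) (n : ℕ) :
    h.homeo.symm^[n] z ∈ square := by
  induction n with
  | zero => exact hz
  | succ n ih => rwa [← h.K_mem_square_iff, h.K_symm_iterate]

/-! ### The separatrix -/

/-- The side `v = π/2` is invariant, so the limit lies on it. Of the cases in `basin_cases` only
this sink and the excluded left corner do. -/
lemma top_ray {u : ℝ} (hu : -(π / 2) < u) (hu' : u ≤ π / 2) :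
    (u, π / 2) ∈ basin (K b c) (π / 2, π / 2) := by
  have hpi := pi_pos
  have hs : (u, π / 2) ∈ square := ⟨⟨hu.le, hu'⟩, by constructor <;> simp only <;> linarith⟩
  have hv : ∀ n : ℕ, ((K b c)^[n] (u, π / 2)).2 = π / 2 := by
    intro n
    induction n with
    | zero => rfl
    | succ n ih => rw [Function.iterate_succ_apply']; simp [K, ih]
  have hl : ∀ p, (u, π / 2) ∈ basin (K b c) p → p.2 = π / 2 := fun p hp => by
    have := (continuous_snd.tendsto p).comp hp
    simp only [Function.comp_def, hv] at this
    exact tendsto_nhds_unique this tendsto_const_nhds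
  rcases h.basin_cases hs with h1 | h1 | h1 | h1 | h1
  · exact h1
  · have := hl _ h1; simp only at this; linarith
  · have := hl _ h1; simp only [Prod.snd_zero] at this; linarith
  · have := congrArg Prod.snd h1; simp only at this; linarith
  · have := congrArg Prod.fst h1; simp only at this; linarith

lemma top_ray' {v : ℝ} (hv : -(π / 2) < v) (hv' : v ≤ π / 2) :
    (π / 2, v) ∈ basin (K b c) (π / 2, π / 2) := by
  simpa using map_mem_basin continuous_swap semiconj_swap (h.swap.top_ray hv hv')

lemma bot_ray {u : ℝ} (hu : -(π / 2) ≤ u) (hu' : u < π / 2) :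
    (u, -(π / 2)) ∈ basin (K b c) (-(π / 2), -(π / 2)) := by
  simpa using map_mem_basin continuous_neg semiconj_neg
    (h.top_ray (u := -u) (by linarith) (by linarith))

/-- Every vertical segment of the square meets the stable set of the origin. -/
lemma exists_mem_basin_zero {u : ℝ} (hu : u ∈ Ioo (-(π / 2)) (π / 2)) :
    ∃ v ∈ Ioo (-(π / 2)) (π / 2), (u, v) ∈ basin (K b c) 0 := by
  have hpi := pi_pos
  have hs : ∀ v ∈ Icc (-(π / 2)) (π / 2), (u, v) ∈ square := fun v hv =>
    ⟨⟨hu.1.le, hu.2.le⟩, hv⟩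
  have hcont : ∀ n : ℕ, Continuous fun v : ℝ => (K b c)^[n] (u, v) := fun n =>
    (continuous_K.iterate n).comp (by fun_prop)
  -- `U` and `V` collect the heights whose orbit enters the open positive or negative quadrant. They
  -- are open and, on the segment, equal the traces of the two disjoint basins. Each contains an end
  -- of the segment, so some height escapes both and must converge to the origin.
  let U : Set ℝ := ⋃ n : ℕ, {v | 0 < ((K b c)^[n] (u, v)).1 ∧ 0 < ((K b c)^[n] (u, v)).2}
  let V : Set ℝ := ⋃ n : ℕ, {v | ((K b c)^[n] (u, v)).1 < 0 ∧ ((K b c)^[n] (u, v)).2 < 0}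
  have hU : IsOpen U := isOpen_iUnion fun n =>
    (isOpen_lt continuous_const (continuous_fst.comp (hcont n))).inter
      (isOpen_lt continuous_const (continuous_snd.comp (hcont n)))
  have hV : IsOpen V := isOpen_iUnion fun n =>
    (isOpen_lt (continuous_fst.comp (hcont n)) continuous_const).inter
      (isOpen_lt (continuous_snd.comp (hcont n)) continuous_const)
  have hUt : ∀ v ∈ Icc (-(π / 2)) (π / 2), v ∈ U ↔ (u, v) ∈ basin (K b c) (π / 2, π / 2) := by
    intro v hv
    constructor
    · rintro ⟨_, ⟨n, rfl⟩, h1, h2⟩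
      refine (iterate_mem_basin_iff n).1 (h.tendsto_top (h.iterate_mem_square (hs v hv) n)
        ⟨h1.le, h2.le⟩ fun h0 => ?_)
      rw [h0] at h1
      exact lt_irrefl _ h1
    · intro ht
      have h1 : ∀ᶠ z : ℝ × ℝ in 𝓝 (π / 2, π / 2), 0 < z.1 ∧ 0 < z.2 :=
        (continuous_fst.tendsto _ |>.eventually_const_lt (by simpa using hpi)).and
          (continuous_snd.tendsto _ |>.eventually_const_lt (by simpa using hpi))
      obtain ⟨n, hn⟩ := (ht.eventually h1).exists
      exact mem_iUnion.2 ⟨n, hn⟩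
  have hVt : ∀ v ∈ Icc (-(π / 2)) (π / 2),
      v ∈ V ↔ (u, v) ∈ basin (K b c) (-(π / 2), -(π / 2)) := by
    intro v hv
    constructor
    · rintro ⟨_, ⟨n, rfl⟩, h1, h2⟩
      refine (iterate_mem_basin_iff n).1 (h.tendsto_bot (h.iterate_mem_square (hs v hv) n)
        ⟨h1.le, h2.le⟩ fun h0 => ?_)
      rw [h0] at h1
      exact lt_irrefl _ h1
    · intro ht
      have h1 : ∀ᶠ z : ℝ × ℝ in 𝓝 (-(π / 2), -(π / 2)), z.1 < 0 ∧ z.2 < 0 :=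
        (continuous_fst.tendsto _ |>.eventually_lt_const (by simpa using hpi)).and
          (continuous_snd.tendsto _ |>.eventually_lt_const (by simpa using hpi))
      obtain ⟨n, hn⟩ := (ht.eventually h1).exists
      exact mem_iUnion.2 ⟨n, hn⟩
  have ml : -(π / 2) ∈ Icc (-(π / 2)) (π / 2) := ⟨le_rfl, by linarith⟩
  have mr : π / 2 ∈ Icc (-(π / 2)) (π / 2) := ⟨by linarith, le_rfl⟩
  have hnot : ¬ Icc (-(π / 2)) (π / 2) ⊆ U ∪ V := by
    intro hsub
    obtain ⟨v, hv, hvU, hvV⟩ := isPreconnected_Icc U V hU hV hsub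
      ⟨_, mr, (hUt _ mr).2 (h.top_ray hu.1 hu.2.le)⟩
      ⟨_, ml, (hVt _ ml).2 (h.bot_ray hu.1.le hu.2)⟩
    have := congrArg Prod.fst (eq_of_mem_basin ((hUt v hv).1 hvU) ((hVt v hv).1 hvV))
    simp only at this
    linarith
  obtain ⟨v, hv, hvn⟩ := not_subset.1 hnot
  rw [mem_union, hUt v hv, hVt v hv, not_or] at hvn
  refine ⟨v, ⟨lt_of_le_of_ne hv.1 ?_, lt_of_le_of_ne hv.2 ?_⟩, ?_⟩
  · rintro rfl; exact hvn.2 (h.bot_ray hu.1.le hu.2)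
  · rintro rfl; exact hvn.1 (h.top_ray hu.1 hu.2.le)
  · rcases h.basin_cases (hs v hv) with h1 | h1 | h1 | h1 | h1
    · exact absurd h1 hvn.1
    · exact absurd h1 hvn.2
    · exact h1
    · exact absurd (congrArg Prod.fst h1) hu.2.ne
    · exact absurd (congrArg Prod.fst h1) hu.1.ne'

/-- Within the square, the stable set of the origin is the graph of `-g` for an odd increasing
homeomorphism `g`, which is extended by the identity. -/
theorem exists_separatrix : ∃ g : ℝ ≃o ℝ,
    (∀ u, u ∉ Ioo (-(π / 2)) (π / 2) → g u = u) ∧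
    (∀ u ∈ Ioo (-(π / 2)) (π / 2), (u, -g u) ∈ basin (K b c) 0) ∧
    ∀ u, g (-u) = -g u := by
  classical
  have hpi := pi_pos
  choose! w hw hw0 using fun u hu => h.exists_mem_basin_zero (u := u) hu
  have hsq : ∀ {u v}, u ∈ Ioo (-(π / 2)) (π / 2) → v ∈ Ioo (-(π / 2)) (π / 2) →
      (u, v) ∈ square := fun hu hv => ⟨⟨hu.1.le, hu.2.le⟩, hv.1.le, hv.2.le⟩
  have huniq : ∀ {u v}, u ∈ Ioo (-(π / 2)) (π / 2) → v ∈ Ioo (-(π / 2)) (π / 2) →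
      (u, v) ∈ basin (K b c) 0 → v = w u := by
    intro u v hu hv h0
    rcases le_total v (w u) with hle | hle
    · exact congrArg Prod.snd (h.eq_of_le_of_mem_basin_zero (hsq hu hv) (hsq hu (hw u hu))
        ⟨le_rfl, hle⟩ h0 (hw0 u hu))
    · exact (congrArg Prod.snd (h.eq_of_le_of_mem_basin_zero (hsq hu (hw u hu)) (hsq hu hv)
        ⟨le_rfl, hle⟩ (hw0 u hu) h0)).symm
  -- The identity outside the interval makes `g` a bijection of the line, and later gives the
  -- correct sign at points that fold outside the square.
  let g : ℝ → ℝ := fun u => if u ∈ Ioo (-(π / 2)) (π / 2) then -w u else u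
  have gin : ∀ u ∈ Ioo (-(π / 2)) (π / 2), g u = -w u := fun u hu => if_pos hu
  have gout : ∀ u, u ∉ Ioo (-(π / 2)) (π / 2) → g u = u := fun u hu => if_neg hu
  have gmem : ∀ u ∈ Ioo (-(π / 2)) (π / 2), g u ∈ Ioo (-(π / 2)) (π / 2) := fun u hu => by
    rw [gin u hu]
    have := hw u hu
    constructor <;> linarith [this.1, this.2]
  have hmono : StrictMono g := by
    intro u u' huu
    by_cases hu : u ∈ Ioo (-(π / 2)) (π / 2)
    · by_cases hu' : u' ∈ Ioo (-(π / 2)) (π / 2)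
      · rw [gin u hu, gin u' hu', neg_lt_neg_iff]
        by_contra hle
        exact huu.ne (congrArg Prod.fst (h.eq_of_le_of_mem_basin_zero (hsq hu (hw u hu))
          (hsq hu' (hw u' hu')) ⟨huu.le, not_lt.1 hle⟩ (hw0 u hu) (hw0 u' hu')))
      · rw [gout u' hu']
        have h1 := gmem u hu
        simp only [mem_Ioo, not_and, not_lt] at hu'
        exact h1.2.trans_le (hu' (hu.1.trans huu))
    · rw [gout u hu]
      by_cases hu' : u' ∈ Ioo (-(π / 2)) (π / 2)
      · have h1 := gmem u' hu'
        refine lt_of_le_of_lt ?_ h1.1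
        by_contra hcon
        exact hu ⟨not_le.1 hcon, huu.trans hu'.2⟩
      · rwa [gout u' hu']
  -- Surjectivity is the existence result for horizontal segments, obtained by exchanging the
  -- coordinates together with `b` and `c`. Once it is known, monotonicity gives continuity.
  have hsurj : Function.Surjective g := by
    intro y
    by_cases hy : y ∈ Ioo (-(π / 2)) (π / 2)
    · have hy' : -y ∈ Ioo (-(π / 2)) (π / 2) := by constructor <;> linarith [hy.1, hy.2]
      obtain ⟨u, hu, hu0⟩ := h.swap.exists_mem_basin_zero hy'
      have := map_mem_basin continuous_swap semiconj_swap hu0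
      refine ⟨u, ?_⟩
      rw [gin u hu, ← huniq hu hy' (by simpa using this), neg_neg]
    · exact ⟨y, gout y hy⟩
  refine ⟨StrictMono.orderIsoOfSurjective g hmono hsurj, gout, fun u hu => ?_, fun u => ?_⟩
  · change (u, -g u) ∈ _
    rw [gin u hu, neg_neg]
    exact hw0 u hu
  · change g (-u) = -g u
    by_cases hu : u ∈ Ioo (-(π / 2)) (π / 2)
    · have hu' : -u ∈ Ioo (-(π / 2)) (π / 2) := by constructor <;> linarith [hu.1, hu.2]
      have hv' : -w u ∈ Ioo (-(π / 2)) (π / 2) := by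
        constructor <;> linarith [(hw u hu).1, (hw u hu).2]
      rw [gin u hu, gin _ hu', ← huniq hu' hv' ?_]
      simpa using map_mem_basin continuous_neg semiconj_neg (hw0 u hu)
    · have hu' : -u ∉ Ioo (-(π / 2)) (π / 2) := fun hn =>
        hu (by constructor <;> linarith [hn.1, hn.2])
      rw [gout u hu, gout _ hu']

/-- The separatrix of the square. -/
def sep : ℝ ≃o ℝ := h.exists_separatrix.choose

lemma sep_of_notMem {u : ℝ} (hu : u ∉ Ioo (-(π / 2)) (π / 2)) : h.sep u = u :=
  h.exists_separatrix.choose_spec.1 u hu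

lemma sep_mem_basin {u : ℝ} (hu : u ∈ Ioo (-(π / 2)) (π / 2)) :
    (u, -h.sep u) ∈ basin (K b c) 0 :=
  h.exists_separatrix.choose_spec.2.1 u hu

lemma sep_neg (u : ℝ) : h.sep (-u) = -h.sep u := h.exists_separatrix.choose_spec.2.2 u

lemma continuous_sep : Continuous h.sep := h.sep.continuous

lemma sep_zero : h.sep 0 = 0 := by
  have := h.sep_neg 0
  rw [neg_zero] at this
  linarith

lemma sep_pi_div_two : h.sep (π / 2) = π / 2 := h.sep_of_notMem fun hn => lt_irrefl _ hn.2

lemma sep_neg_pi_div_two : h.sep (-(π / 2)) = -(π / 2) :=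
  h.sep_of_notMem fun hn => lt_irrefl _ hn.1

lemma sep_graph_mem_square {u : ℝ} (hu : u ∈ Icc (-(π / 2)) (π / 2)) : (u, -h.sep u) ∈ square := by
  have h1 := h.sep.monotone hu.1
  have h2 := h.sep.monotone hu.2
  rw [h.sep_neg_pi_div_two] at h1
  rw [h.sep_pi_div_two] at h2
  refine ⟨hu, ?_, ?_⟩ <;> simp only <;> linarith

/-- The points of the square in the stable set of the origin. -/
lemma mem_basin_zero_iff {z : ℝ × ℝ} (hz : z ∈ square) :
    z ∈ basin (K b c) 0 ↔ z.1 ∈ Ioo (-(π / 2)) (π / 2) ∧ z.2 = -h.sep z.1 := by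
  have hpi := pi_pos
  constructor
  · intro h0
    have hu : z.1 ∈ Ioo (-(π / 2)) (π / 2) := by
      refine ⟨lt_of_le_of_ne hz.1.1 fun e => ?_, lt_of_le_of_ne hz.1.2 fun e => ?_⟩
      · have := fst_eq_of_mem_basin (by simp) e.symm h0
        simp only [Prod.fst_zero] at this; linarith
      · have := fst_eq_of_mem_basin (by simp) e h0
        simp only [Prod.fst_zero] at this; linarith
    refine ⟨hu, ?_⟩
    have hs := h.sep_graph_mem_square ⟨hu.1.le, hu.2.le⟩
    rcases le_total z.2 (-h.sep z.1) with hle | hle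
    · exact congrArg Prod.snd (h.eq_of_le_of_mem_basin_zero hz hs ⟨le_rfl, hle⟩ h0
        (h.sep_mem_basin hu))
    · exact (congrArg Prod.snd (h.eq_of_le_of_mem_basin_zero hs hz ⟨le_rfl, hle⟩
        (h.sep_mem_basin hu) h0)).symm
  · rintro ⟨hu, hv⟩
    have : z = (z.1, -h.sep z.1) := Prod.ext rfl hv
    rw [this]
    exact h.sep_mem_basin hu

/-- The points of the square in the basin of the sink `(π/2, π/2)`. -/
lemma mem_basin_top_iff {z : ℝ × ℝ} (hz : z ∈ square) :
    z ∈ basin (K b c) (π / 2, π / 2) ↔ 0 < h.sep z.1 + z.2 := by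
  have hpi := pi_pos
  by_cases hu : z.1 ∈ Ioo (-(π / 2)) (π / 2)
  · have hs := h.sep_graph_mem_square ⟨hu.1.le, hu.2.le⟩
    have hb0 := h.sep_mem_basin hu
    have hz' : ∀ e : ℝ, z = (e, -e) ∨ z = (-e, e) → e ≠ π / 2 := by
      rintro e (e1 | e1) rfl <;> rw [e1] at hu <;> simp at hu
    constructor
    · intro ht
      by_contra hcon
      have := h.basin_top_upper hz hs ⟨le_rfl, by simp only; linarith⟩ ht
      have := congrArg Prod.fst (eq_of_mem_basin this hb0)
      simp only [Prod.fst_zero] at this; linarith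
    · intro hpos
      rcases h.basin_cases hz with h1 | h1 | h1 | h1 | h1
      · exact h1
      · have := h.basin_bot_lower hs hz ⟨le_rfl, by simp only; linarith⟩ h1
        have := congrArg Prod.fst (eq_of_mem_basin this hb0)
        simp only [Prod.fst_zero] at this; linarith
      · have := ((h.mem_basin_zero_iff hz).1 h1).2
        linarith
      · exact absurd rfl (hz' _ (.inl h1))
      · exact absurd rfl (hz' _ (.inr h1))
  · have hu' : z.1 = π / 2 ∨ z.1 = -(π / 2) := by
      by_contra hcon
      push Not at hcon
      exact hu ⟨lt_of_le_of_ne hz.1.1 (Ne.symm hcon.2), lt_of_le_of_ne hz.1.2 hcon.1⟩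
    rcases hu' with e | e
    · have hze : z = (π / 2, z.2) := Prod.ext e rfl
      rw [e, h.sep_pi_div_two]
      constructor
      · intro ht
        rcases lt_or_eq_of_le hz.2.1 with h2 | h2
        · linarith
        · have hf : K b c z = z := K_corner (by simp [e]) (by simp [← h2])
          have := congrArg Prod.snd (eq_of_fixed_of_mem_basin hf ht)
          simp only at this; linarith
      · intro hpos
        rw [hze]
        exact h.top_ray' (by linarith) hz.2.2
    · rw [e, h.sep_neg_pi_div_two]
      constructor
      · intro ht
        have := fst_eq_of_mem_basin (by simp) e ht
        simp only at this; linarith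
      · intro hpos
        linarith [hz.2.2]

/-! ### The whole basin -/

/-- Under `t ↦ π - t` the sine is unchanged and the cosine changes sign, so `K` commutes with the
reflections in `u = π/2` and `v = π/2`. Since `u = π/2` is never crossed, the same branch of `fold`
applies before and after a step. -/
lemma fold_fst_K (z : ℝ × ℝ) : fold (K b c z).1 = (K b c (fold z.1, fold z.2)).1 := by
  have hs : sin (fold z.2) = sin z.2 := by
    rcases le_total z.2 (π / 2) with ht | ht
    · rw [fold_of_le ht]
    · rw [fold_of_ge ht, sin_pi_sub]
  rcases le_or_gt z.1 (π / 2) with ht | ht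
  · have h1 : (K b c z).1 ≤ π / 2 := not_lt.1 fun h1 =>
      absurd ((h.lt_fst_iff cos_pi_div_two z).1 h1) (not_lt.2 ht)
    rw [fold_of_le h1]
    simp only [K, hs, fold_of_le ht]
  · have h1 := (h.lt_fst_iff cos_pi_div_two z).2 ht
    rw [fold_of_ge h1.le]
    simp only [K, hs, fold_of_ge ht.le, cos_pi_sub]
    ring

lemma fold_K (z : ℝ × ℝ) : (fold (K b c z).1, fold (K b c z).2) = K b c (fold z.1, fold z.2) := by
  refine Prod.ext (h.fold_fst_K z) ?_
  have := h.swap.fold_fst_K z.swap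
  rw [fst_K_swap, Prod.fst_swap, Prod.snd_swap] at this
  exact this.trans (fst_K_swap (fold z.1, fold z.2))

/-- The basin of the sink `(π/2, π/2)` in the whole plane. -/
theorem mem_basin_iff (z : ℝ × ℝ) :
    z ∈ basin (K b c) (π / 2, π / 2) ↔ 0 < h.sep (fold z.1) + fold z.2 := by
  have hpi := pi_pos
  have hfold : Function.Semiconj (fun z : ℝ × ℝ => (fold z.1, fold z.2)) (K b c) (K b c) :=
    h.fold_K
  have hcont : Continuous fun z : ℝ × ℝ => (fold z.1, fold z.2) :=
    (continuous_fold.comp continuous_fst).prodMk (continuous_fold.comp continuous_snd)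
  have htop : fold (π / 2) = π / 2 := fold_of_le le_rfl
  have hiff : z ∈ basin (K b c) (π / 2, π / 2) ↔
      (fold z.1, fold z.2) ∈ basin (K b c) (π / 2, π / 2) := by
    constructor
    · intro hz
      simpa [htop] using map_mem_basin hcont hfold hz
    · intro hz
      have e : ∀ n : ℕ, (K b c)^[n] (fold z.1, fold z.2) =
          (fold ((K b c)^[n] z).1, fold ((K b c)^[n] z).2) := fun n =>
        ((hfold.iterate_right n).eq z).symm
      have hz1 : Tendsto (fun n : ℕ => fold ((K b c)^[n] z).1) atTop (𝓝 (π / 2)) := by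
        have := (continuous_fst.tendsto _).comp hz
        simpa only [Function.comp_def, e] using this
      have hz2 : Tendsto (fun n : ℕ => fold ((K b c)^[n] z).2) atTop (𝓝 (π / 2)) := by
        have := (continuous_snd.tendsto _).comp hz
        simpa only [Function.comp_def, e] using this
      -- Since `π/2 - fold x = |x - π/2|`, convergence of the folded sequence to `π/2` forces that
      -- of the original one.
      have key : ∀ x : ℕ → ℝ, Tendsto (fun n => fold (x n)) atTop (𝓝 (π / 2)) →
          Tendsto x atTop (𝓝 (π / 2)) := by
        intro x hx
        rw [tendsto_iff_dist_tendsto_zero]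
        have := hx.const_sub (π / 2)
        simpa [fold, Real.dist_eq] using this
      exact (key _ hz1).prodMk_nhds (key _ hz2)
  rw [hiff]
  by_cases hs : (fold z.1, fold z.2) ∈ square
  · exact h.mem_basin_top_iff hs
  -- A folded coordinate below `-π/2` stays there forever, so the sink is not reached. The level is
  -- not positive either, because the other fold is at most `π/2`.
  · have hlow : fold z.1 < -(π / 2) ∨ fold z.2 < -(π / 2) := by
      by_contra hcon
      push Not at hcon
      exact hs ⟨⟨hcon.1, fold_le _⟩, hcon.2, fold_le _⟩
    have f1 := fold_le z.1
    have f2 := fold_le z.2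
    have hk : cos (-(π / 2)) = 0 := by simp
    rcases hlow with h1 | h1
    · have hright : ¬ 0 < h.sep (fold z.1) + fold z.2 := by
        rw [h.sep_of_notMem fun hn => lt_asymm hn.1 h1]; linarith
      refine iff_of_false (fun ht => ?_) hright
      have hv : ∀ n : ℕ, ((K b c)^[n] (fold z.1, fold z.2)).1 < -(π / 2) := by
        intro n
        induction n with
        | zero => exact h1
        | succ n ih => rw [Function.iterate_succ_apply']; exact (h.fst_lt_iff hk _).2 ih
      have := le_of_tendsto' ((continuous_fst.tendsto _).comp ht) fun n => (hv n).le
      simp only at this; linarith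
    · have hright : ¬ 0 < h.sep (fold z.1) + fold z.2 := by
        have := h.sep.monotone f1
        rw [h.sep_pi_div_two] at this; linarith
      refine iff_of_false (fun ht => ?_) hright
      have hv : ∀ n : ℕ, ((K b c)^[n] (fold z.1, fold z.2)).2 < -(π / 2) := by
        intro n
        induction n with
        | zero => exact h1
        | succ n ih => rw [Function.iterate_succ_apply']; exact (h.snd_lt_iff hk _).2 ih
      have := le_of_tendsto' ((continuous_snd.tendsto _).comp ht) fun n => (hv n).le
      simp only at this; linarith

end Admissible

lemma fold_homothety {s t : ℝ} (hs : 0 ≤ s) :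
    fold (π / 2 + s * (t - π / 2)) = π / 2 - s * |t - π / 2| := by
  unfold fold
  rw [add_sub_cancel_left, abs_mul, abs_of_nonneg hs]

lemma top_mem_basin : ((π / 2, π / 2) : ℝ × ℝ) ∈ basin (K b c) (π / 2, π / 2) :=
  mem_basin_of_fixed (K_corner (by simp) (by simp))

/-- This reparametrizes half of the graph over the whole real line, as the definition of a
heteroclinic curve demands. -/
lemma range_half_arctan : range (fun t => arctan t / 2 - π / 4) = Ioo (-(π / 2)) 0 := by
  ext u
  constructor
  · rintro ⟨t, rfl⟩
    have h1 := neg_pi_div_two_lt_arctan t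
    have h2 := arctan_lt_pi_div_two t
    constructor <;> simp only <;> linarith
  · intro hu
    refine ⟨tan (2 * u + π / 2), ?_⟩
    simp only
    rw [arctan_tan (by linarith [hu.1]) (by linarith [hu.2])]
    ring

namespace Admissible

variable (h : Admissible b c)
include h

/-! ### Topology of the basin -/

lemma continuous_level : Continuous fun z : ℝ × ℝ => h.sep (fold z.1) + fold z.2 :=
  (h.continuous_sep.comp (continuous_fold.comp continuous_fst)).add
    (continuous_fold.comp continuous_snd)

lemma basin_eq : basin (K b c) (π / 2, π / 2) = {z | 0 < h.sep (fold z.1) + fold z.2} :=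
  Set.ext h.mem_basin_iff

lemma isOpen_basin : IsOpen (basin (K b c) (π / 2, π / 2)) := by
  rw [h.basin_eq]
  exact isOpen_lt continuous_const h.continuous_level

lemma fold_mem_Icc {z : ℝ × ℝ} (hz : 0 ≤ h.sep (fold z.1) + fold z.2) :
    fold z.1 ∈ Icc (-(π / 2)) (π / 2) ∧ fold z.2 ∈ Icc (-(π / 2)) (π / 2) := by
  have f1 := fold_le z.1
  have f2 := fold_le z.2
  refine ⟨⟨?_, f1⟩, ?_, f2⟩
  · by_contra hcon
    rw [h.sep_of_notMem fun hn => hcon hn.1.le] at hz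
    linarith
  · have := h.sep.monotone f1
    rw [h.sep_pi_div_two] at this
    linarith

lemma basin_subset : basin (K b c) (π / 2, π / 2) ⊆
    Icc (-(π / 2)) (3 * π / 2) ×ˢ Icc (-(π / 2)) (3 * π / 2) := by
  intro z hz
  obtain ⟨h1, h2⟩ := h.fold_mem_Icc ((h.mem_basin_iff z).1 hz).le
  exact ⟨neg_pi_div_two_le_fold.1 h1.1, neg_pi_div_two_le_fold.1 h2.1⟩

/-- Contracting towards the sink increases the defining function of the basin. -/
lemma level_lt {z : ℝ × ℝ} (hz : z ≠ (π / 2, π / 2)) {s : ℝ} (hs : 0 ≤ s) (hs1 : s < 1) :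
    h.sep (fold z.1) + fold z.2 < h.sep (fold (π / 2 + s * (z.1 - π / 2))) +
      fold (π / 2 + s * (z.2 - π / 2)) := by
  rw [fold_homothety hs, fold_homothety hs]
  have a1 := abs_nonneg (z.1 - π / 2)
  have a2 := abs_nonneg (z.2 - π / 2)
  have i1 : fold z.1 ≤ π / 2 - s * |z.1 - π / 2| := by unfold fold; nlinarith
  have i2 : fold z.2 ≤ π / 2 - s * |z.2 - π / 2| := by unfold fold; nlinarith
  by_cases h1 : z.1 = π / 2
  · have h2 : z.2 ≠ π / 2 := fun h2 => hz (Prod.ext h1 h2)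
    have a2' : 0 < |z.2 - π / 2| := abs_pos.2 (sub_ne_zero.2 h2)
    have i2' : fold z.2 < π / 2 - s * |z.2 - π / 2| := by unfold fold; nlinarith
    exact add_lt_add_of_le_of_lt (h.sep.monotone i1) i2'
  · have a1' : 0 < |z.1 - π / 2| := abs_pos.2 (sub_ne_zero.2 h1)
    have i1' : fold z.1 < π / 2 - s * |z.1 - π / 2| := by unfold fold; nlinarith
    exact add_lt_add_of_lt_of_le (h.sep.strictMono i1') i2

/-- By `level_lt` the basin is star-shaped about the sink, hence contractible. -/
lemma isSimplyConnected_basin : IsSimplyConnected (basin (K b c) (π / 2, π / 2)) := by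
  have hstar : StarConvex ℝ (π / 2, π / 2) (basin (K b c) (π / 2, π / 2)) := by
    intro z hz r s hr hs hrs
    by_cases hz' : z = (π / 2, π / 2)
    · rw [hz', ← add_smul, hrs, one_smul]
      exact top_mem_basin
    have e : r • ((π / 2, π / 2) : ℝ × ℝ) + s • z =
        (π / 2 + s * (z.1 - π / 2), π / 2 + s * (z.2 - π / 2)) := by
      obtain rfl : r = 1 - s := by linarith
      ext <;> simp <;> ring
    rw [h.mem_basin_iff] at hz
    rcases eq_or_lt_of_le (show s ≤ 1 by linarith) with h1 | h1
    · obtain rfl : r = 0 := by linarith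
      rw [h1, zero_smul, zero_add, one_smul, h.mem_basin_iff]
      exact hz
    · rw [e, h.mem_basin_iff]
      exact hz.trans (h.level_lt hz' hs h1)
  have := hstar.contractibleSpace ⟨_, top_mem_basin⟩
  unfold IsSimplyConnected
  infer_instance

/-- A point of level at least zero is the limit of the points on its segment to the sink, which have
positive level. -/
lemma closure_basin : closure (basin (K b c) (π / 2, π / 2)) =
    {z | 0 ≤ h.sep (fold z.1) + fold z.2} := by
  refine Subset.antisymm (closure_minimal (fun z hz => ((h.mem_basin_iff z).1 hz).le)
    (isClosed_le continuous_const h.continuous_level)) fun z hz => ?_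
  by_cases hz' : z = (π / 2, π / 2)
  · rw [hz']; exact subset_closure top_mem_basin
  let γ : ℝ → ℝ × ℝ := fun s => (π / 2 + s * (z.1 - π / 2), π / 2 + s * (z.2 - π / 2))
  have hγ : Continuous γ := by fun_prop
  have h1 : γ 1 = z := by ext <;> simp [γ]
  have hlim : Tendsto γ (𝓝[<] 1) (𝓝 z) := by
    have := (hγ.tendsto 1).mono_left (nhdsWithin_le_nhds (s := Iio 1))
    rwa [h1] at this
  refine mem_closure_of_tendsto hlim ?_
  filter_upwards [Ioo_mem_nhdsLT (show (0 : ℝ) < 1 by norm_num)] with s hs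
  rw [h.mem_basin_iff]
  exact lt_of_le_of_lt hz (h.level_lt hz' hs.1.le hs.2)

lemma frontier_basin : frontier (basin (K b c) (π / 2, π / 2)) =
    {z | h.sep (fold z.1) + fold z.2 = 0} := by
  rw [h.isOpen_basin.frontier_eq, h.closure_basin, h.basin_eq]
  ext z
  simp only [Set.mem_sdiff, mem_ofPred_eq, not_lt]
  exact ⟨fun hz => le_antisymm hz.2 hz.1, fun hz => ⟨hz.ge, hz.le⟩⟩

/-! ### The stable and unstable curves of the saddle -/

/-- The stable graph decreases through the origin. Leaving its left half would mean a jump to the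
opposite mixed quadrant, excluded by `no_jump'`, or landing on the origin, excluded by injectivity.
-/
lemma fst_K_neg {z : ℝ × ℝ} (hz : z ∈ square) (h0 : z ∈ basin (K b c) 0) (h1 : z.1 < 0) :
    (K b c z).1 < 0 := by
  have hz' := h.K_mem_square_iff.2 hz
  have e := ((h.mem_basin_zero_iff hz).1 h0).2
  have e' := ((h.mem_basin_zero_iff hz').1 (apply_mem_basin_iff.2 h0)).2
  have h2 : 0 < z.2 := by
    have := h.sep.strictMono h1
    rw [h.sep_zero] at this; linarith
  by_contra hcon
  rw [not_lt] at hcon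
  have h3 : (K b c z).2 ≤ 0 := by
    have := h.sep.monotone hcon
    rw [h.sep_zero] at this; linarith
  have h4 : (K b c z).1 = 0 := by
    rcases h.no_jump' hz h1.le h2.le with h5 | h5
    · exact le_antisymm h5 hcon
    · have : h.sep (K b c z).1 = h.sep 0 := by rw [h.sep_zero]; linarith
      exact h.sep.injective this
  have h5 : K b c z = 0 := Prod.ext h4 (by rw [e', h4, h.sep_zero]; simp)
  have : z = 0 := h.homeo.injective (by rw [h.coe_homeo, h5, K_zero])
  rw [this] at h1
  exact lt_irrefl _ h1

lemma fst_K_neg_iff {z : ℝ × ℝ} (hz : z ∈ square) (h0 : z ∈ basin (K b c) 0) :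
    (K b c z).1 < 0 ↔ z.1 < 0 := by
  refine ⟨fun h1 => ?_, h.fst_K_neg hz h0⟩
  by_contra hcon
  rcases eq_or_lt_of_le (not_lt.1 hcon) with h2 | h2
  · have e := ((h.mem_basin_zero_iff hz).1 h0).2
    have : z = 0 := Prod.ext h2.symm (by rw [e, ← h2, h.sep_zero]; simp)
    rw [this, K_zero] at h1
    exact lt_irrefl _ h1
  · have h0' := map_mem_basin continuous_neg semiconj_neg h0
    rw [neg_zero] at h0'
    have := h.fst_K_neg (neg_mem_square hz) h0' (by simpa using h2)
    rw [K_neg] at this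
    simp only [Prod.fst_neg] at this
    linarith

/-- The half of the stable curve of the origin that comes from the corner `(-π/2, π/2)`. -/
def arc : Set (ℝ × ℝ) := (fun u => (u, -h.sep u)) '' Ioo (-(π / 2)) 0

lemma mem_arc_iff {z : ℝ × ℝ} : z ∈ h.arc ↔ z ∈ square ∧ z ∈ basin (K b c) 0 ∧ z.1 < 0 := by
  have hpi := pi_pos
  constructor
  · rintro ⟨u, hu, rfl⟩
    have hu' : u ∈ Ioo (-(π / 2)) (π / 2) := ⟨hu.1, by linarith [hu.2]⟩
    exact ⟨h.sep_graph_mem_square ⟨hu'.1.le, hu'.2.le⟩, h.sep_mem_basin hu', hu.2⟩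
  · rintro ⟨hs, h0, h1⟩
    obtain ⟨hu, hv⟩ := (h.mem_basin_zero_iff hs).1 h0
    exact ⟨z.1, ⟨hu.1, h1⟩, Prod.ext rfl hv.symm⟩

lemma K_mem_arc_iff {z : ℝ × ℝ} : K b c z ∈ h.arc ↔ z ∈ h.arc := by
  rw [h.mem_arc_iff, h.mem_arc_iff, h.K_mem_square_iff, apply_mem_basin_iff]
  constructor
  · rintro ⟨hs, h0, h1⟩; exact ⟨hs, h0, (h.fst_K_neg_iff hs h0).1 h1⟩
  · rintro ⟨hs, h0, h1⟩; exact ⟨hs, h0, (h.fst_K_neg_iff hs h0).2 h1⟩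

/-- In the mixed quadrant the backward orbit moves monotonically away from the origin, so its limit
is a fixed point at least as far out: the corner. -/
lemma tendsto_backward_of_mem_arc {z : ℝ × ℝ} (hz : z ∈ h.arc) :
    Tendsto (fun n : ℕ => h.homeo.symm^[n] z) atTop (𝓝 (-(π / 2), π / 2)) := by
  have hpi := pi_pos
  have ha : ∀ n : ℕ, h.homeo.symm^[n] z ∈ h.arc := by
    intro n
    induction n with
    | zero => exact hz
    | succ n ih => rwa [← h.K_mem_arc_iff, h.K_symm_iterate]
  have hs : ∀ n : ℕ, h.homeo.symm^[n] z ∈ square := fun n => (h.mem_arc_iff.1 (ha n)).1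
  have hneg : ∀ n : ℕ, (h.homeo.symm^[n] z).1 < 0 := fun n => (h.mem_arc_iff.1 (ha n)).2.2
  have hpos : ∀ n : ℕ, 0 < (h.homeo.symm^[n] z).2 := fun n => by
    have e := ((h.mem_basin_zero_iff (hs n)).1 (h.mem_arc_iff.1 (ha n)).2.1).2
    have := h.sep.strictMono (hneg n)
    rw [h.sep_zero] at this; linarith
  have m1 : Antitone fun n : ℕ => (h.homeo.symm^[n] z).1 := antitone_nat_of_succ_le fun n => by
    have := h.le_fst (hs (n + 1)) (hpos (n + 1)).le
    rwa [h.K_symm_iterate] at this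
  have m2 : Monotone fun n : ℕ => (h.homeo.symm^[n] z).2 := monotone_nat_of_le_succ fun n => by
    have := h.snd_le (hs (n + 1)) (hneg (n + 1)).le
    rwa [h.K_symm_iterate] at this
  obtain ⟨y, hy, hl⟩ := exists_tendsto_of_mem_square hs (.inr m1) (.inl m2)
  have hf := fixed_of_tendsto_backward continuous_K (fun n => h.K_symm_iterate n z) hl
  have k1 : y.1 ≤ z.1 := m1.le_of_tendsto ((continuous_fst.tendsto y).comp hl) 0
  have k2 : z.2 ≤ y.2 := m2.ge_of_tendsto ((continuous_snd.tendsto y).comp hl) 0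
  have z1 : z.1 < 0 := hneg 0
  have z2 : 0 < z.2 := hpos 0
  have : y = (-(π / 2), π / 2) := by
    rcases h.fixed_cases hy hf with rfl | ⟨e1, e2⟩
    · simp only [Prod.fst_zero] at k1; linarith
    · refine Prod.ext (e1.resolve_left fun e => ?_) (e2.resolve_right fun e => ?_) <;> linarith
  rwa [this] at hl

/-- The arc is a heteroclinic curve from the repeller `(-π/2, π/2)` to the saddle `0`. -/
theorem isHeteroclinicCurve_arc : IsHeteroclinicCurve (K b c) (-(π / 2), π / 2) 0 h.arc := by
  have hpi := pi_pos
  refine ⟨⟨(fun u => (u, -h.sep u)) ∘ fun t => arctan t / 2 - π / 4, ?_, ?_, ?_, ?_, ?_⟩, ?_, ?_⟩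
  · exact (continuous_id.prodMk h.continuous_sep.neg).comp (by fun_prop)
  · intro s t hst
    have := congrArg Prod.fst hst
    simp only [Function.comp_apply] at this
    exact arctan_injective (by linarith)
  · rw [range_comp, range_half_arctan]; rfl
  · have h1 : Tendsto (fun t => arctan t / 2 - π / 4) atBot (𝓝 (-(π / 2))) := by
      have := ((tendsto_arctan_atBot.mono_right nhdsWithin_le_nhds).div_const 2).sub_const (π / 4)
      rwa [show -(π / 2) / 2 - π / 4 = -(π / 2) by ring] at this
    have h2 := ((continuous_id.prodMk h.continuous_sep.neg).tendsto (-(π / 2))).comp h1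
    simpa [h.sep_neg_pi_div_two] using h2
  · have h1 : Tendsto (fun t => arctan t / 2 - π / 4) atTop (𝓝 0) := by
      have := ((tendsto_arctan_atTop.mono_right nhdsWithin_le_nhds).div_const 2).sub_const (π / 4)
      rwa [show π / 2 / 2 - π / 4 = 0 by ring] at this
    have h2 := ((continuous_id.prodMk h.continuous_sep.neg).tendsto 0).comp h1
    simpa [h.sep_zero, ← Prod.zero_eq_mk] using h2
  · ext z
    constructor
    · rintro ⟨w, hw, rfl⟩; exact h.K_mem_arc_iff.2 hw
    · intro hz
      exact ⟨h.homeo.symm z, by rwa [← h.K_mem_arc_iff, h.K_symm], h.K_symm z⟩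
  · intro z hz
    obtain ⟨X, hX, h0, hf, hb⟩ := exists_isOrbit h.homeo z
    refine ⟨X, hX, h0, tendsto_int_atBot ?_, tendsto_int_atTop ?_⟩
    · simpa only [hb] using h.tendsto_backward_of_mem_arc hz
    · simp only [hf]
      exact (h.mem_arc_iff.1 hz).2.1

/-- The mixed quadrant `u < 0 < v` is backward invariant in the square. -/
lemma mixed_of_K_mixed {z : ℝ × ℝ} (hz : z ∈ square) (h1 : (K b c z).1 < 0)
    (h2 : 0 < (K b c z).2) : z.1 < 0 ∧ 0 < z.2 := by
  by_contra hcon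
  rcases le_total 0 z.1 with a1 | a1
  · rcases le_total 0 z.2 with a2 | a2
    · exact absurd (h.K_nonneg hz ⟨a1, a2⟩).1 (not_le.2 h1)
    · rcases h.no_jump hz a1 a2 with a3 | a3 <;> linarith
  · rcases le_or_gt z.2 0 with a2 | a2
    · exact absurd (h.K_nonpos hz ⟨a1, a2⟩).2 (not_le.2 h2)
    · rcases eq_or_lt_of_le a1 with a3 | a3
      · exact absurd (h.K_nonneg hz ⟨a3.ge, a2.le⟩).1 (not_le.2 h1)
      · exact hcon ⟨a3, a2⟩

lemma mixed_of_K_mixed' {z : ℝ × ℝ} (hz : z ∈ square) (h1 : 0 < (K b c z).1)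
    (h2 : (K b c z).2 < 0) : 0 < z.1 ∧ z.2 < 0 := by
  have := h.mixed_of_K_mixed (neg_mem_square hz) (by rw [K_neg]; simpa using h1)
    (by rw [K_neg]; simpa using h2)
  simpa using this

/-- A backward orbit that stays in the positive quadrant converges to the origin unless it starts
at the sink. -/
lemma tendsto_backward_of_nonneg {z : ℝ × ℝ} (hz : z ∈ square) (hne : z ≠ (π / 2, π / 2))
    (hp : ∀ n : ℕ, 0 ≤ h.homeo.symm^[n] z) :
    Tendsto (fun n : ℕ => h.homeo.symm^[n] z) atTop (𝓝 0) := by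
  have hpi := pi_pos
  have hs := h.symm_iterate_mem_square hz
  have m1 : Antitone fun n : ℕ => (h.homeo.symm^[n] z).1 := antitone_nat_of_succ_le fun n => by
    have := h.le_fst (hs (n + 1)) (hp (n + 1)).2
    rwa [h.K_symm_iterate] at this
  have m2 : Antitone fun n : ℕ => (h.homeo.symm^[n] z).2 := antitone_nat_of_succ_le fun n => by
    have := h.le_snd (hs (n + 1)) (hp (n + 1)).1
    rwa [h.K_symm_iterate] at this
  obtain ⟨y, hy, hl⟩ := exists_tendsto_of_mem_square hs (.inr m1) (.inr m2)
  have hf := fixed_of_tendsto_backward continuous_K (fun n => h.K_symm_iterate n z) hl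
  have l1 : Tendsto (fun n : ℕ => (h.homeo.symm^[n] z).1) atTop (𝓝 y.1) :=
    (continuous_fst.tendsto y).comp hl
  have l2 : Tendsto (fun n : ℕ => (h.homeo.symm^[n] z).2) atTop (𝓝 y.2) :=
    (continuous_snd.tendsto y).comp hl
  have k1 : y.1 ≤ z.1 := m1.le_of_tendsto l1 0
  have k2 : y.2 ≤ z.2 := m2.le_of_tendsto l2 0
  have j1 : 0 ≤ y.1 := ge_of_tendsto' l1 fun n => (hp n).1
  have j2 : 0 ≤ y.2 := ge_of_tendsto' l2 fun n => (hp n).2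
  rcases h.fixed_cases hy hf with rfl | ⟨e1, e2⟩
  · exact hl
  · have e1 := e1.resolve_right fun e => by linarith
    have e2 := e2.resolve_right fun e => by linarith
    exact absurd (Prod.ext (le_antisymm hz.1.2 (by linarith)) (le_antisymm hz.2.2 (by linarith)))
      hne

/-- The top side is invariant and `K` moves its points with `0 ≤ u < π/2` to the right, so the
preimage of its midpoint lies to the left of the midpoint. -/
lemma symm_fst_neg : (h.homeo.symm (0, π / 2)).1 < 0 ∧ 0 < (h.homeo.symm (0, π / 2)).2 := by
  have hpi := pi_pos
  have hk := h.K_symm (0, π / 2)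
  have hs : ((0, π / 2) : ℝ × ℝ) ∈ square :=
    ⟨⟨by simp only; linarith, by simp only; linarith⟩, by simp only; linarith, le_rfl⟩
  have hs' : h.homeo.symm (0, π / 2) ∈ square := h.symm_iterate_mem_square hs 1
  generalize h.homeo.symm (0, π / 2) = z at *
  have h2 : z.2 = π / 2 := by
    have a1 := (h.snd_lt_iff cos_pi_div_two z).not
    rw [hk] at a1
    exact le_antisymm hs'.2.2 (not_lt.1 (a1.1 (lt_irrefl _)))
  refine ⟨?_, by linarith⟩
  by_contra hcon
  have hcon := not_lt.1 hcon
  have e := congrArg Prod.fst hk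
  simp only [K, h2, sin_pi_div_two, mul_one] at e
  have hc : 0 ≤ cos z.1 := cos_nonneg_of_mem_Icc ⟨hs'.1.1, hs'.1.2⟩
  have hb := h.b_pos
  have h0 : z.1 = 0 := by nlinarith [mul_nonneg hb.le hc]
  rw [h0, cos_zero] at e
  linarith

/-- The unstable set of the saddle meets the open positive quadrant of the square. -/
theorem exists_unstable : ∃ z ∈ square, 0 ≤ z ∧ z ≠ 0 ∧ z ∈ unstableSet (K b c) 0 := by
  have hpi := pi_pos
  -- This segment joins `(0, π/2)` to `(π/2, 0)`. One backward step sends its ends into opposite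
  -- mixed quadrants, so by connectedness some point of it has a backward orbit that never enters
  -- either.
  let s : ℝ → ℝ × ℝ := fun u => (u, π / 2 - u)
  have hs : ∀ u ∈ Icc 0 (π / 2), s u ∈ square := fun u hu => by
    refine ⟨⟨?_, ?_⟩, ?_, ?_⟩ <;> simp only [s] <;> linarith [hu.1, hu.2]
  have hcont : ∀ n : ℕ, Continuous fun u : ℝ => h.homeo.symm^[n] (s u) := fun n =>
    (h.homeo.symm.continuous.iterate n).comp (by fun_prop)
  let U : Set ℝ := ⋃ n : ℕ, {u | (h.homeo.symm^[n] (s u)).1 < 0 ∧ 0 < (h.homeo.symm^[n] (s u)).2}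
  let V : Set ℝ := ⋃ n : ℕ, {u | 0 < (h.homeo.symm^[n] (s u)).1 ∧ (h.homeo.symm^[n] (s u)).2 < 0}
  have hU : IsOpen U := isOpen_iUnion fun n =>
    (isOpen_lt (continuous_fst.comp (hcont n)) continuous_const).inter
      (isOpen_lt continuous_const (continuous_snd.comp (hcont n)))
  have hV : IsOpen V := isOpen_iUnion fun n =>
    (isOpen_lt continuous_const (continuous_fst.comp (hcont n))).inter
      (isOpen_lt (continuous_snd.comp (hcont n)) continuous_const)
  have hnot : ¬ Icc 0 (π / 2) ⊆ U ∪ V := by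
    intro hsub
    have hl : (0 : ℝ) ∈ U := mem_iUnion.2 ⟨1, by simpa [s] using h.symm_fst_neg⟩
    have hr : π / 2 ∈ V := by
      refine mem_iUnion.2 ⟨1, ?_⟩
      have e : h.homeo.symm (π / 2, 0) = (h.swap.homeo.symm (0, π / 2)).swap := by
        apply h.homeo.injective
        rw [h.homeo.apply_symm_apply, h.coe_homeo, ← K_swap, h.swap.K_symm]
        rfl
      have := h.swap.symm_fst_neg
      simp only [Function.iterate_one, s, sub_self, e, mem_ofPred_eq, Prod.fst_swap, Prod.snd_swap]
      exact ⟨this.2, this.1⟩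
    obtain ⟨u, hu, huU, huV⟩ := isPreconnected_Icc U V hU hV hsub
      ⟨0, ⟨le_rfl, by linarith⟩, hl⟩ ⟨π / 2, ⟨by linarith, le_rfl⟩, hr⟩
    obtain ⟨m, hm⟩ := mem_iUnion.1 huU
    obtain ⟨k, hk⟩ := mem_iUnion.1 huV
    have hsq := h.symm_iterate_mem_square (hs u hu)
    -- The mixed quadrants are backward invariant, so a point of `U` and `V` would be in both at
    -- time `m + k`.
    have hm' : ∀ n : ℕ, (h.homeo.symm^[m + n] (s u)).1 < 0 ∧
        0 < (h.homeo.symm^[m + n] (s u)).2 := by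
      intro n
      induction n with
      | zero => exact hm
      | succ n ih =>
        exact h.mixed_of_K_mixed (hsq _) (by rw [← add_assoc, h.K_symm_iterate]; exact ih.1)
          (by rw [← add_assoc, h.K_symm_iterate]; exact ih.2)
    have hk' : ∀ n : ℕ, 0 < (h.homeo.symm^[k + n] (s u)).1 ∧
        (h.homeo.symm^[k + n] (s u)).2 < 0 := by
      intro n
      induction n with
      | zero => exact hk
      | succ n ih =>
        exact h.mixed_of_K_mixed' (hsq _) (by rw [← add_assoc, h.K_symm_iterate]; exact ih.1)
          (by rw [← add_assoc, h.K_symm_iterate]; exact ih.2)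
    have h1 := (hm' k).1
    have h2 := (hk' m).1
    rw [add_comm k m] at h2
    linarith
  obtain ⟨u, hu, hun⟩ := not_subset.1 hnot
  have hsq := h.symm_iterate_mem_square (hs u hu)
  have hne0 : s u ≠ 0 := fun e => by
    have e1 := congrArg Prod.fst e
    have e2 := congrArg Prod.snd e
    simp only [s, Prod.fst_zero, Prod.snd_zero] at e1 e2
    linarith
  have hpos0 : 0 ≤ s u := ⟨hu.1, by simp only [s, Prod.snd_zero]; linarith [hu.2]⟩
  have hiter : ∀ n : ℕ, (K b c)^[n] (h.homeo.symm^[n] (s u)) = s u := fun n =>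
    (Function.LeftInverse.iterate (f := h.homeo.symm) (g := K b c) h.K_symm n) (s u)
  -- The closed negative quadrant is forward invariant, and `s u` is nonnegative and nonzero, so no
  -- preimage lies there.
  have hnp : ∀ n : ℕ, ¬ h.homeo.symm^[n] (s u) ≤ 0 := fun n hn => by
    have := h.iterate_le_iterate (hsq n) zero_mem_square hn n
    rw [hiter, Function.iterate_fixed K_zero] at this
    exact hne0 (le_antisymm this hpos0)
  have hp : ∀ n : ℕ, 0 ≤ h.homeo.symm^[n] (s u) := by
    intro n
    have h1 : ¬ ((h.homeo.symm^[n] (s u)).1 < 0 ∧ 0 < (h.homeo.symm^[n] (s u)).2) := fun hn =>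
      hun (.inl (mem_iUnion.2 ⟨n, hn⟩))
    have h2 : ¬ (0 < (h.homeo.symm^[n] (s u)).1 ∧ (h.homeo.symm^[n] (s u)).2 < 0) := fun hn =>
      hun (.inr (mem_iUnion.2 ⟨n, hn⟩))
    have h3 : ¬ ((h.homeo.symm^[n] (s u)).1 ≤ 0 ∧ (h.homeo.symm^[n] (s u)).2 ≤ 0) := hnp n
    constructor <;> simp only [Prod.fst_zero, Prod.snd_zero] <;> by_contra hcon <;> grind
  refine ⟨s u, hs u hu, hpos0, hne0, ?_⟩
  refine mem_unstableSet_of_tendsto (f := h.homeo)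
    (h.tendsto_backward_of_nonneg (hs u hu) (fun e => ?_) hp)
  have e1 := congrArg Prod.fst e
  have e2 := congrArg Prod.snd e
  simp only [s] at e1 e2
  linarith

end Admissible

/-! ### Multipliers -/

lemma hasFDerivAt_F (a : ℝ) (p : ℝ × ℝ) : HasFDerivAt (F a)
    (((1 + 2 * a * cos p.1) • ContinuousLinearMap.fst ℝ ℝ ℝ +
      (a * cos p.2) • ContinuousLinearMap.snd ℝ ℝ ℝ).prod
      ((a * cos p.1) • ContinuousLinearMap.fst ℝ ℝ ℝ +
        (1 + 2 * a * cos p.2) • ContinuousLinearMap.snd ℝ ℝ ℝ)) p := by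
  have h1 : HasFDerivAt (fun z : ℝ × ℝ => z.1) (ContinuousLinearMap.fst ℝ ℝ ℝ) p := hasFDerivAt_fst
  have h2 : HasFDerivAt (fun z : ℝ × ℝ => z.2) (ContinuousLinearMap.snd ℝ ℝ ℝ) p := hasFDerivAt_snd
  have e := ((h1.add (h1.sin.const_mul (2 * a))).add (h2.sin.const_mul a)).prodMk
    ((h2.add (h1.sin.const_mul a)).add (h2.sin.const_mul (2 * a)))
  refine e.congr_fderiv ?_
  ext <;> simp [mul_assoc]

/-- The multipliers of `F` at `p` are the roots of the characteristic equation. -/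
lemma mem_multipliers_F_iff {a : ℝ} {p : ℝ × ℝ} {r s : ℝ}
    (ht : 2 + 2 * a * cos p.1 + 2 * a * cos p.2 = r + s)
    (hd : (1 + 2 * a * cos p.1) * (1 + 2 * a * cos p.2) - a ^ 2 * cos p.1 * cos p.2 = r * s)
    {μ : ℂ} : μ ∈ multipliers (F a) p ↔ μ = r ∨ μ = s := by
  have e : ((fderiv ℝ (F a) p : (ℝ × ℝ) →L[ℝ] (ℝ × ℝ)) : (ℝ × ℝ) →ₗ[ℝ] (ℝ × ℝ)) =
      Matrix.toLin (Module.Basis.finTwoProd ℝ) (Module.Basis.finTwoProd ℝ)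
        !![1 + 2 * a * cos p.1, a * cos p.2; a * cos p.1, 1 + 2 * a * cos p.2] := by
    rw [(hasFDerivAt_F a p).fderiv, Matrix.toLin_finTwoProd]
    rfl
  have hchar : ((fderiv ℝ (F a) p : (ℝ × ℝ) →L[ℝ] (ℝ × ℝ)) :
      (ℝ × ℝ) →ₗ[ℝ] (ℝ × ℝ)).charpoly =
      (Polynomial.X - Polynomial.C r) * (Polynomial.X - Polynomial.C s) := by
    rw [e, ← LinearMap.charpoly_toMatrix _ (Module.Basis.finTwoProd ℝ), LinearMap.toMatrix_toLin,
      Matrix.charpoly_fin_two, Matrix.trace_fin_two, Matrix.det_fin_two]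
    have t1 : 1 + 2 * a * cos p.1 + (1 + 2 * a * cos p.2) = r + s := by linarith
    have t2 : (1 + 2 * a * cos p.1) * (1 + 2 * a * cos p.2) - a * cos p.2 * (a * cos p.1) =
        r * s := by linarith
    simp only [Matrix.of_apply, Matrix.cons_val', Matrix.cons_val_zero, Matrix.cons_val_one,
      Matrix.cons_val_fin_one, t1, t2]
    simp only [map_add, map_mul]
    ring
  have hne : (Polynomial.X - Polynomial.C r) * (Polynomial.X - Polynomial.C s) ≠ 0 :=
    mul_ne_zero (Polynomial.X_sub_C_ne_zero r) (Polynomial.X_sub_C_ne_zero s)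
  change μ ∈ Polynomial.aroots _ ℂ ↔ _
  rw [hchar, Polynomial.mem_aroots]
  simp [hne, sub_eq_zero]

lemma F_eq_self {a : ℝ} {p : ℝ × ℝ} (h1 : sin p.1 = 0) (h2 : sin p.2 = 0) : F a p = p := by
  ext <;> simp [F, h1, h2]

lemma isSink_of_cos {a : ℝ} (ha0 : 0 < a) (ha1 : a < 1 / 6) {p : ℝ × ℝ} (s1 : sin p.1 = 0)
    (s2 : sin p.2 = 0) (c1 : cos p.1 = -1) (c2 : cos p.2 = -1) : IsSink (F a) p := by
  refine ⟨F_eq_self s1 s2, (hasFDerivAt_F a p).differentiableAt, fun μ hμ => ?_⟩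
  rw [mem_multipliers_F_iff (r := 1 - 3 * a) (s := 1 - a) (by rw [c1, c2]; ring)
    (by rw [c1, c2]; ring)] at hμ
  rcases hμ with rfl | rfl <;> rw [Complex.norm_real, norm_eq_abs, abs_lt] <;>
    constructor <;> linarith

lemma isRepeller_of_cos {a : ℝ} (ha0 : 0 < a) {p : ℝ × ℝ} (s1 : sin p.1 = 0)
    (s2 : sin p.2 = 0) (c1 : cos p.1 = 1) (c2 : cos p.2 = 1) : IsRepeller (F a) p := by
  refine ⟨F_eq_self s1 s2, (hasFDerivAt_F a p).differentiableAt, fun μ hμ => ?_⟩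
  rw [mem_multipliers_F_iff (r := 1 + 3 * a) (s := 1 + a) (by rw [c1, c2]; ring)
    (by rw [c1, c2]; ring)] at hμ
  rcases hμ with rfl | rfl <;> rw [Complex.norm_real, norm_eq_abs, lt_abs] <;> left <;> linarith

lemma isSaddle_of_cos {a : ℝ} (ha0 : 0 < a) (ha1 : a < 1 / 6) {p : ℝ × ℝ} (s1 : sin p.1 = 0)
    (s2 : sin p.2 = 0) (hs : cos p.1 + cos p.2 = 0) (hm : cos p.1 * cos p.2 = -1) :
    IsSaddle (F a) p := by
  have h3 : √3 * √3 = 3 := mul_self_sqrt (by norm_num)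
  have h3' : 0 < √3 := by positivity
  have h3'' : √3 < 2 := by nlinarith
  have hpos : 0 < √3 * a := by positivity
  have hlt : √3 * a < 1 := by nlinarith
  -- With cosines of opposite sign the trace is `2` and the determinant `1 - 3a²`.
  have key : ∀ μ : ℂ, μ ∈ multipliers (F a) p ↔
      μ = ((1 - √3 * a : ℝ) : ℂ) ∨ μ = ((1 + √3 * a : ℝ) : ℂ) := fun μ =>
    mem_multipliers_F_iff (by linear_combination 2 * a * hs)
      (by linear_combination 2 * a * hs + 3 * a ^ 2 * hm + a ^ 2 * h3)
  have n1 : ‖((1 - √3 * a : ℝ) : ℂ)‖ < 1 := by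
    rw [Complex.norm_real, norm_eq_abs, abs_lt]; constructor <;> linarith
  have n2 : 1 < ‖((1 + √3 * a : ℝ) : ℂ)‖ := by
    rw [Complex.norm_real, norm_eq_abs, lt_abs]; left; linarith
  refine ⟨F_eq_self s1 s2, (hasFDerivAt_F a p).differentiableAt, fun μ hμ => ?_,
    ⟨_, (key _).2 (.inl rfl), n1⟩, ⟨_, (key _).2 (.inr rfl), n2⟩⟩
  rcases (key μ).1 hμ with rfl | rfl
  exacts [n1.ne, n2.ne']

/-! ### Transfer from the normal form -/

/-- The change of coordinates from the normal form to `F`. -/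
def coord : ℝ × ℝ ≃ₜ ℝ × ℝ where
  toFun z := (z.1 + z.2, π + z.1 - z.2)
  invFun z := ((z.1 + z.2 - π) / 2, (z.1 - z.2 + π) / 2)
  left_inv z := by ext <;> simp <;> ring
  right_inv z := by ext <;> simp <;> ring
  continuous_toFun := by fun_prop
  continuous_invFun := by fun_prop

lemma coord_apply (z : ℝ × ℝ) : coord z = (z.1 + z.2, π + z.1 - z.2) := rfl

/-- The sum and the difference of the phases diagonalize the coupling matrix with rows `(2, 1)` and
`(1, 2)`, whose eigenvalues 3 and 1 give the coefficients. The addition formulas turn sums of sines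
into products. -/
lemma semiconj_coord (a : ℝ) : Function.Semiconj coord (K (3 * a) a) (F a) := by
  intro z
  have e : sin (π + z.1 - z.2) = -sin (z.1 - z.2) := by
    rw [add_sub_assoc, add_comm, sin_add_pi]
  rw [coord_apply, coord_apply]
  ext
  · simp only [K, F, e, sin_add, sin_sub]; ring
  · simp only [K, F, e, sin_add, sin_sub]; ring

lemma semiconj_coord_symm (a : ℝ) : Function.Semiconj coord.symm (F a) (K (3 * a) a) := by
  intro z
  apply coord.injective
  rw [(semiconj_coord a).eq, coord.apply_symm_apply, coord.apply_symm_apply]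

lemma coord_top : coord (π / 2, π / 2) = (π, π) := by rw [coord_apply]; ext <;> simp

lemma basin_F_eq (a : ℝ) :
    basin (F a) (π, π) = coord '' basin (K (3 * a) a) (π / 2, π / 2) := by
  ext z
  constructor
  · intro hz
    refine ⟨coord.symm z, ?_, coord.apply_symm_apply z⟩
    have := map_mem_basin coord.symm.continuous (semiconj_coord_symm a) hz
    rwa [← coord_top, coord.symm_apply_apply] at this
  · rintro ⟨w, hw, rfl⟩
    have := map_mem_basin coord.continuous (semiconj_coord a) hw
    rwa [coord_top] at this

lemma admissible {a : ℝ} (ha0 : 0 < a) (ha1 : a < 1 / 6) : Admissible (3 * a) a :=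
  ⟨by linarith, by linarith, ha0, by linarith⟩

/-! ### Symmetries -/

lemma sin_add_two_pi_mul (x : ℝ) (l : ℤ) : sin (x + 2 * π * l) = sin x := by
  rw [mul_comm (2 * π)]; exact sin_add_int_mul_two_pi x l

lemma semiconj_translation (a : ℝ) (l k : ℤ) :
    Function.Semiconj (translation l k) (F a) (F a) := by
  intro z
  ext <;> simp only [translation, F, sin_add_two_pi_mul] <;> ring

/-- The point reflections that map the lattice of repellers to itself. -/
def reflection (l k : ℤ) (z : ℝ × ℝ) : ℝ × ℝ := translation l k (-z)

lemma semiconj_reflection (a : ℝ) (l k : ℤ) :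
    Function.Semiconj (reflection l k) (F a) (F a) := by
  intro z
  have e : -F a z = F a (-z) := by ext <;> simp [F] <;> ring
  rw [reflection, e, (semiconj_translation a l k).eq]
  rfl

lemma semiconj_swap_F (a : ℝ) : Function.Semiconj Prod.swap (F a) (F a) := by
  intro z
  ext <;> simp only [F, Prod.fst_swap, Prod.snd_swap] <;> ring

/-- The translations as homeomorphisms. -/
def translationHomeo (l k : ℤ) : ℝ × ℝ ≃ₜ ℝ × ℝ where
  toFun := translation l k
  invFun := translation (-l) (-k)
  left_inv z := by ext <;> simp [translation]
  right_inv z := by ext <;> simp [translation]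
  continuous_toFun := by unfold translation; fun_prop
  continuous_invFun := by unfold translation; fun_prop

lemma continuous_translation (l k : ℤ) : Continuous (translation l k) :=
  (translationHomeo l k).continuous

lemma injective_translation (l k : ℤ) : Function.Injective (translation l k) :=
  (translationHomeo l k).injective

lemma continuous_reflection (l k : ℤ) : Continuous (reflection l k) :=
  (continuous_translation l k).comp continuous_neg

lemma injective_reflection (l k : ℤ) : Function.Injective (reflection l k) :=
  (injective_translation l k).comp neg_injective

/-- A symmetry of `F` that fixes the sink preserves the closure of its basin. -/
lemma map_mem_closure_basin {a : ℝ} {σ : ℝ × ℝ → ℝ × ℝ} (hσ : Continuous σ)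
    (hF : Function.Semiconj σ (F a) (F a)) (hfix : σ (π, π) = (π, π)) {z : ℝ × ℝ}
    (hz : z ∈ closure (basin (F a) (π, π))) : σ z ∈ closure (basin (F a) (π, π)) :=
  map_mem_closure hσ hz fun w hw => by simpa only [hfix] using map_mem_basin hσ hF hw

/-- The closures of two disjoint sets, one of them open, have disjoint interiors. -/
lemma disjoint_interior_closure {X : Type*} [TopologicalSpace X] {U V : Set X} (hV : IsOpen V)
    (h : Disjoint U V) : Disjoint (interior (closure U)) (interior (closure V)) :=
  (((h.closure_left hV).mono_left interior_subset).closure_right isOpen_interior).mono_right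
    interior_subset

variable {a : ℝ}

section

variable (h : Admissible (3 * a) a)
include h

/-- `F` as a homeomorphism. -/
def homeoF : ℝ × ℝ ≃ₜ ℝ × ℝ := coord.symm.trans (h.homeo.trans coord)

lemma coe_homeoF : ⇑(homeoF h) = F a := by
  funext z
  change coord (K (3 * a) a (coord.symm z)) = F a z
  rw [(semiconj_coord a).eq, coord.apply_symm_apply]

lemma image_basin_F (p : ℝ × ℝ) : F a '' basin (F a) p = basin (F a) p := by
  ext z
  constructor
  · rintro ⟨w, hw, rfl⟩; exact apply_mem_basin_iff.2 hw
  · intro hz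
    have e : F a ((homeoF h).symm z) = z := by
      rw [← coe_homeoF h, (homeoF h).apply_symm_apply]
    exact ⟨_, by rwa [← apply_mem_basin_iff, e], e⟩

lemma image_closure_basin_F (p : ℝ × ℝ) :
    F a '' closure (basin (F a) p) = closure (basin (F a) p) := by
  conv_rhs => rw [← image_basin_F h p]
  rw [← coe_homeoF h, (homeoF h).image_closure]

lemma image_frontier_basin_F (p : ℝ × ℝ) :
    F a '' frontier (basin (F a) p) = frontier (basin (F a) p) := by
  conv_rhs => rw [← image_basin_F h p]
  rw [← coe_homeoF h, (homeoF h).image_frontier]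

lemma isOpen_basin_F : IsOpen (basin (F a) (π, π)) := by
  rw [basin_F_eq, coord.isOpen_image]; exact h.isOpen_basin

lemma isBounded_basin_F : Bornology.IsBounded (basin (F a) (π, π)) := by
  rw [basin_F_eq]
  exact ((isCompact_Icc.prod isCompact_Icc).image coord.continuous).isBounded.subset
    (image_mono h.basin_subset)

lemma isSimplyConnected_basin_F : IsSimplyConnected (basin (F a) (π, π)) := by
  rw [basin_F_eq, coord.isSimplyConnected_image]; exact h.isSimplyConnected_basin

lemma closure_basin_F : closure (basin (F a) (π, π)) =
    coord '' {z | 0 ≤ h.sep (fold z.1) + fold z.2} := by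
  rw [basin_F_eq, ← coord.image_closure, h.closure_basin]

lemma frontier_basin_F : frontier (basin (F a) (π, π)) =
    coord '' {z | h.sep (fold z.1) + fold z.2 = 0} := by
  rw [basin_F_eq, ← coord.image_frontier, h.frontier_basin]

/-! ### The edges of the tile -/

/-- A parametrization of the left edge (`i = 0`) and of the right edge (`i = 1`) by the interval
`[-π/2, π/2]`. -/
def edge (i : Fin 2) (t : ℝ) : ℝ × ℝ := (t - h.sep t + 2 * π * (i : ℕ), π + t + h.sep t)

/-- The vertical heteroclinic curves. -/
def vertical (i j : Fin 2) : Set (ℝ × ℝ) :=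
  edge h i '' (if j = 0 then Ioo (-(π / 2)) 0 else Ioo 0 (π / 2))

lemma edge_neg_pi_div_two (i : Fin 2) : edge h i (-(π / 2)) = corner i 0 := by
  ext <;> simp [edge, corner, h.sep_neg_pi_div_two]
  ring

lemma edge_zero (i : Fin 2) : edge h i 0 = midV i := by
  ext <;> simp [edge, midV, h.sep_zero]

lemma edge_pi_div_two (i : Fin 2) : edge h i (π / 2) = corner i 1 := by
  ext <;> simp [edge, corner, h.sep_pi_div_two]
  ring

lemma image_edge_Icc (i : Fin 2) : edge h i '' Icc (-(π / 2)) (π / 2) =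
    {corner i 0} ∪ {corner i 1} ∪ {midV i} ∪ vertical h i 0 ∪ vertical h i 1 := by
  have hpi := pi_pos
  have hI : Icc (-(π / 2)) (π / 2) =
      {-(π / 2)} ∪ {π / 2} ∪ {0} ∪ Ioo (-(π / 2)) 0 ∪ Ioo 0 (π / 2) := by
    ext t
    simp only [mem_Icc, mem_union, mem_singleton_iff, mem_Ioo]
    constructor
    · rintro ⟨h1, h2⟩
      rcases h1.eq_or_lt with h1 | h1
      · simp [h1]
      rcases h2.eq_or_lt with h2 | h2
      · simp [h2]
      rcases lt_trichotomy t 0 with h3 | h3 | h3 <;> simp [*]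
    · rintro ((((rfl | rfl) | rfl) | ⟨h1, h2⟩) | ⟨h1, h2⟩) <;> constructor <;> linarith
  rw [hI]
  simp only [image_union, image_singleton, edge_neg_pi_div_two, edge_zero, edge_pi_div_two]
  simp [vertical]

/-- Lower halves of the vertical edges are translates of the one known arc, and upper halves are
point reflections of it. The coordinate swap supplies the horizontal ones. -/
lemma vertical_zero (i : Fin 2) :
    vertical h i 0 = translation (i : ℕ) 0 '' (coord '' h.arc) := by
  simp only [vertical, Admissible.arc, if_true, image_image]
  refine image_congr fun t _ => ?_
  ext <;> simp [edge, translation, coord_apply]; ring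

lemma vertical_one (i : Fin 2) :
    vertical h i 1 = reflection (i : ℕ) 1 '' (coord '' h.arc) := by
  have hneg : Ioo 0 (π / 2) = (fun t => -t) '' Ioo (-(π / 2)) 0 := by simp
  simp only [vertical, Admissible.arc, one_ne_zero, if_false, hneg, image_image]
  refine image_congr fun t _ => ?_
  ext <;> simp [edge, reflection, translation, coord_apply, h.sep_neg] <;> ring

lemma isHeteroclinicCurve_vertical (i j : Fin 2) :
    IsHeteroclinicCurve (F a) (corner i j) (midV i) (vertical h i j) := by
  have h0 := h.isHeteroclinicCurve_arc.image coord.continuous coord.injective (semiconj_coord a)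
  have e1 : coord (-(π / 2), π / 2) = (0, 0) := by rw [coord_apply]; ext <;> simp; ring
  have e2 : coord 0 = (0, π) := by rw [coord_apply]; ext <;> simp
  rw [e1, e2] at h0
  have hj : j = 0 ∨ j = 1 := by omega
  rcases hj with rfl | rfl
  · have := h0.image (continuous_translation (i : ℕ) 0) (injective_translation _ _)
      (semiconj_translation a _ _)
    rw [vertical_zero]
    convert this using 1
    · simp [corner, translation]
    · simp [midV, translation]
  · have := h0.image (continuous_reflection (i : ℕ) 1) (injective_reflection _ _)
      (semiconj_reflection a _ _)
    rw [vertical_one]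
    convert this using 1
    · simp [corner, translation, reflection]
    · simp [midV, translation, reflection]; ring

lemma isHeteroclinicCurve_horizontal (i j : Fin 2) :
    IsHeteroclinicCurve (F a) (corner i j) (midH j) (Prod.swap '' vertical h j i) :=
  (isHeteroclinicCurve_vertical h j i).image continuous_swap Prod.swap_injective
    (semiconj_swap_F a)

/-- The boundary of the basin consists of four edges. -/
lemma mem_frontier_iff (z : ℝ × ℝ) : z ∈ frontier (basin (F a) (π, π)) ↔
    ∃ i : Fin 2, z ∈ edge h i '' Icc (-(π / 2)) (π / 2) ∨
      z.swap ∈ edge h i '' Icc (-(π / 2)) (π / 2) := by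
  have hpi := pi_pos
  rw [frontier_basin_F h, Fin.exists_fin_two]
  constructor
  · rintro ⟨⟨u, v⟩, hz, rfl⟩
    obtain ⟨h1, h2⟩ := h.fold_mem_Icc (Eq.ge hz)
    simp only [mem_ofPred_eq] at hz h1 h2
    have hodd : h.sep (π - u) = -h.sep (u - π) := by rw [← h.sep_neg]; congr 1; ring
    -- Each of the four quadrants around the sink contributes one edge: left, bottom, top and right,
    -- in this order. Where `u` is folded, the edge parameter is `u - π`.
    rcases le_total u (π / 2) with hu | hu <;> rcases le_total v (π / 2) with hv | hv
    · rw [fold_of_le hu] at hz h1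
      rw [fold_of_le hv] at hz
      refine .inl (.inl ⟨u, h1, ?_⟩)
      ext <;> simp [edge, coord_apply] <;> linarith
    · rw [fold_of_le hu] at hz h1
      rw [fold_of_ge hv] at hz
      refine .inl (.inr ⟨u, h1, ?_⟩)
      ext <;> simp [edge, coord_apply] <;> linarith
    · rw [fold_of_ge hu] at hz h1
      rw [fold_of_le hv, hodd] at hz
      refine .inr (.inr ⟨u - π, ⟨by linarith [h1.2], by linarith [h1.1]⟩, ?_⟩)
      ext <;> simp [edge, coord_apply] <;> linarith
    · rw [fold_of_ge hu] at hz h1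
      rw [fold_of_ge hv, hodd] at hz
      refine .inr (.inl ⟨u - π, ⟨by linarith [h1.2], by linarith [h1.1]⟩, ?_⟩)
      ext <;> simp [edge, coord_apply] <;> linarith
  · have key : ∀ t ∈ Icc (-(π / 2)) (π / 2), h.sep t ≤ π / 2 ∧ -(π / 2) ≤ h.sep t := by
      intro t ht
      have := h.sep_graph_mem_square ht
      exact ⟨by linarith [this.2.1], by linarith [this.2.2]⟩
    have hodd : ∀ t, h.sep (π - (t + π)) = -h.sep t := fun t => by
      rw [← h.sep_neg]; congr 1; ring
    rintro ((⟨t, ht, e⟩ | ⟨t, ht, e⟩) | (⟨t, ht, e⟩ | ⟨t, ht, e⟩))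
    · refine ⟨(t, -h.sep t), ?_, ?_⟩
      · simp only [mem_ofPred_eq]
        rw [fold_of_le ht.2, fold_of_le (by linarith [(key t ht).2])]; ring
      · rw [← e]; ext <;> simp [edge, coord_apply]; ring
    · refine ⟨(t, π + h.sep t), ?_, ?_⟩
      · simp only [mem_ofPred_eq]
        rw [fold_of_le ht.2, fold_of_ge (by linarith [(key t ht).2])]; ring
      · rw [← Prod.swap_swap z, ← e]; ext <;> simp [edge, coord_apply]; ring
    · refine ⟨(t + π, π - h.sep t), ?_, ?_⟩
      · simp only [mem_ofPred_eq]
        rw [fold_of_ge (by linarith [ht.1]), fold_of_ge (by linarith [(key t ht).1]), hodd]; ring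
      · rw [← e]; ext <;> simp [edge, coord_apply] <;> ring
    · refine ⟨(t + π, h.sep t), ?_, ?_⟩
      · simp only [mem_ofPred_eq]
        rw [fold_of_ge (by linarith [ht.1]), fold_of_le (key t ht).1, hodd]; ring
      · rw [← Prod.swap_swap z, ← e]; ext <;> simp [edge, coord_apply] <;> ring

omit h in
lemma mem_swap_image_iff {s : Set (ℝ × ℝ)} {z : ℝ × ℝ} : z ∈ Prod.swap '' s ↔ z.swap ∈ s := by
  rw [image_swap_eq_preimage_swap]; rfl

/-- The boundary of the basin as a union of fixed points and heteroclinic curves. -/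
theorem frontier_eq : frontier (basin (F a) (π, π)) =
    (⋃ i : Fin 2, ⋃ j : Fin 2,
      ({corner i j} ∪ Prod.swap '' vertical h j i ∪ vertical h i j)) ∪
      range midH ∪ range midV := by
  ext z
  have hc : ∀ i j, z.swap = corner i j ↔ z = corner j i := fun i j =>
    Prod.swap_eq_iff_eq_swap
  have hm : ∀ i, z.swap = midV i ↔ z = midH i := fun i => Prod.swap_eq_iff_eq_swap
  rw [mem_frontier_iff h]
  simp only [image_edge_Icc, mem_union, mem_iUnion, mem_singleton_iff, mem_range,
    mem_swap_image_iff, Fin.exists_fin_two, hc, hm, eq_comm (b := z)]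
  tauto

lemma corner_mem_frontier (i j : Fin 2) : corner i j ∈ frontier (basin (F a) (π, π)) := by
  rw [frontier_eq h]
  refine .inl (.inl ?_)
  simp only [mem_iUnion]
  exact ⟨i, j, .inl (.inl rfl)⟩

lemma midH_mem_frontier (j : Fin 2) : midH j ∈ frontier (basin (F a) (π, π)) := by
  rw [frontier_eq h]
  exact .inl (.inr ⟨j, rfl⟩)

lemma midV_mem_frontier (i : Fin 2) : midV i ∈ frontier (basin (F a) (π, π)) := by
  rw [frontier_eq h]
  exact .inr ⟨i, rfl⟩

/-- The unstable point lies in the positive quadrant of the normal form, hence in the basin itself.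
-/
lemma exists_unstable_midV_zero : ∃ z ∈ closure (basin (F a) (π, π)),
    z ≠ midV 0 ∧ z ∈ unstableSet (F a) (midV 0) := by
  obtain ⟨z, hs, h0, hne, hz⟩ := h.exists_unstable
  have e : coord 0 = midV 0 := by rw [coord_apply]; ext <;> simp [midV]
  refine ⟨coord z, subset_closure ?_, ?_, ?_⟩
  · rw [basin_F_eq]
    exact mem_image_of_mem _ (h.tendsto_top hs h0 hne)
  · rw [← e]
    exact fun he => hne (coord.injective he)
  · rw [← e]
    exact map_mem_unstableSet coord.continuous (semiconj_coord a) hz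

lemma exists_unstable_midV (i : Fin 2) : ∃ z ∈ closure (basin (F a) (π, π)),
    z ≠ midV i ∧ z ∈ unstableSet (F a) (midV i) := by
  have hi : i = 0 ∨ i = 1 := by omega
  rcases hi with rfl | rfl
  · exact exists_unstable_midV_zero h
  · obtain ⟨z, hz, hne, hu⟩ := exists_unstable_midV_zero h
    have e : reflection 1 1 (midV 0) = midV 1 := by
      ext <;> simp [reflection, translation, midV]; ring
    have etop : reflection 1 1 (π, π) = (π, π) := by
      ext <;> simp [reflection, translation] <;> ring
    refine ⟨reflection 1 1 z, map_mem_closure_basin (continuous_reflection 1 1)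
      (semiconj_reflection a 1 1) etop hz, ?_, ?_⟩
    · rw [← e]
      exact (injective_reflection 1 1).ne hne
    · rw [← e]
      exact map_mem_unstableSet (continuous_reflection 1 1) (semiconj_reflection a 1 1) hu

lemma nonempty_vertical (i j : Fin 2) : (vertical h i j).Nonempty := by
  obtain ⟨⟨γ, -, -, hr, -⟩, -⟩ := isHeteroclinicCurve_vertical h i j
  exact ⟨γ 0, hr ▸ mem_range_self 0⟩

lemma exists_stable_midV (i : Fin 2) : ∃ z ∈ closure (basin (F a) (π, π)),
    z ≠ midV i ∧ z ∈ basin (F a) (midV i) := by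
  have hpi := pi_pos
  obtain ⟨z, hz⟩ := nonempty_vertical h i 0
  obtain ⟨-, -, ho⟩ := isHeteroclinicCurve_vertical h i 0
  obtain ⟨X, hX, h0, hb, ht⟩ := ho z hz
  have hXn : ∀ n : ℕ, X n = (F a)^[n] z := by
    intro n
    induction n with
    | zero => exact h0
    | succ n ih => rw [Function.iterate_succ_apply', ← ih, ← hX]; norm_cast
  refine ⟨z, ?_, ?_, ?_⟩
  · refine frontier_subset_closure ?_
    rw [frontier_eq h]
    refine .inl (.inl ?_)
    simp only [mem_iUnion]
    exact ⟨i, 0, .inr hz⟩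
  -- On the lower half edge the parameter is negative, so the second coordinate is strictly below
  -- `π`.
  · rintro rfl
    obtain ⟨t, ht, e⟩ := hz
    rw [if_pos rfl] at ht
    have e2 := congrArg Prod.snd e
    have := h.sep.strictMono ht.2
    rw [h.sep_zero] at this
    simp only [edge, midV] at e2
    linarith [ht.2]
  · have := ht.comp (tendsto_natCast_atTop_atTop (R := ℤ))
    simp only [Function.comp_def, hXn] at this
    exact this

/-! ### The tiling -/

/-- Every point of the plane lies in a translate of the closure of the basin. -/
lemma iUnion_translates : (⋃ t : ℤ × ℤ,
    translation t.1 t.2 '' closure (basin (F a) (π, π))) = univ := by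
  have hpi := pi_pos
  refine eq_univ_of_forall fun z => ?_
  have hw : z = coord (coord.symm z) := (coord.apply_symm_apply z).symm
  generalize coord.symm z = w at hw
  obtain ⟨u, v⟩ := w
  -- A shift by `(π s, π r)` in the normal form is a shift by `(π (s + r), π (s - r))` in the plane.
  -- It is a lattice translation exactly when `s + r` is even, with indices `l = (s + r) / 2` and `s
  -- - l`.
  have key : ∀ (p q : ℝ) (s r : ℤ), 0 ≤ h.sep (fold p) + fold q → u = p + π * s →
      v = q + π * r → Even (s + r) → z ∈ ⋃ t : ℤ × ℤ,
        translation t.1 t.2 '' closure (basin (F a) (π, π)) := by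
    rintro p q s r hpq hu hv ⟨l, hl⟩
    refine mem_iUnion.2 ⟨(l, s - l), coord (p, q), ?_, ?_⟩
    · rw [closure_basin_F h]
      exact mem_image_of_mem _ hpq
    · have hl' : (s : ℝ) + r = l + l := by exact_mod_cast hl
      rw [hw, hu, hv, coord_apply, coord_apply]
      have hr : (r : ℝ) = l + l - s := by linarith
      ext <;> simp only [translation, hr] <;> push_cast <;> ring
  have hround : ∀ x : ℝ, ∃ m : ℤ, |x - π * m| ≤ π / 2 := fun x => by
    refine ⟨round (x / π), ?_⟩
    have := abs_sub_round (x / π)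
    have e : x - π * round (x / π) = π * (x / π - round (x / π)) := by field_simp
    rw [e, abs_mul, abs_of_pos hpi]
    nlinarith
  obtain ⟨m, hm⟩ := hround u
  obtain ⟨n, hn⟩ := hround v
  obtain ⟨u', hu'⟩ : ∃ u', u' = u - π * m := ⟨_, rfl⟩
  obtain ⟨v', hv'⟩ : ∃ v', v' = v - π * n := ⟨_, rfl⟩
  rw [← hu', abs_le] at hm
  rw [← hv', abs_le] at hn
  have hfu : fold u' = u' := fold_of_le hm.2
  have hfv : fold v' = v' := fold_of_le hn.2
  have hfu' : fold (u' + π) = -u' := by rw [fold_of_ge (by linarith)]; ring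
  have hfv' : fold (v' + π) = -v' := by rw [fold_of_ge (by linarith)]; ring
  -- Parity decides whether both or neither, or exactly one, of the reduced coordinates must be
  -- shifted by `π`. In each case the two choices have opposite levels, so one of them is
  -- nonnegative.
  rcases Int.even_or_odd (m + n) with hmn | hmn
  · rcases le_total 0 (h.sep u' + v') with hs | hs
    · exact key u' v' m n (by rwa [hfu, hfv]) (by rw [hu']; ring) (by rw [hv']; ring) hmn
    · refine key (u' + π) (v' + π) (m - 1) (n - 1) (by rw [hfu', hfv', h.sep_neg]; linarith)
        (by rw [hu']; push_cast; ring) (by rw [hv']; push_cast; ring) ?_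
      rw [show m - 1 + (n - 1) = m + n - 2 by ring]
      exact hmn.sub (by decide)
  · rcases le_total 0 (h.sep u' - v') with hs | hs
    · refine key u' (v' + π) m (n - 1) (by rw [hfu, hfv']; linarith)
        (by rw [hu']; ring) (by rw [hv']; push_cast; ring) ?_
      rw [← add_sub_assoc]
      exact hmn.sub_odd odd_one
    · refine key (u' + π) v' (m - 1) n (by rw [hfu', hfv, h.sep_neg]; linarith)
        (by rw [hu']; push_cast; ring) (by rw [hv']; ring) ?_
      rw [show m - 1 + n = m + n - 1 by ring]
      exact hmn.sub_odd odd_one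

omit h in
-- The translates are contained in the basins of distinct sinks, and an orbit has at most one limit.
lemma disjoint_translates {s t : ℤ × ℤ} (hst : s ≠ t) :
    Disjoint (translation s.1 s.2 '' basin (F a) (π, π))
      (translation t.1 t.2 '' basin (F a) (π, π)) := by
  have hpi := pi_pos
  rw [disjoint_left]
  rintro _ ⟨z, hz, rfl⟩ ⟨w, hw, e⟩
  have h1 := map_mem_basin (continuous_translation s.1 s.2) (semiconj_translation a s.1 s.2) hz
  have h2 := map_mem_basin (continuous_translation t.1 t.2) (semiconj_translation a t.1 t.2) hw
  rw [e] at h2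
  have e' := eq_of_mem_basin h1 h2
  have e1 := congrArg Prod.fst e'
  have e2 := congrArg Prod.snd e'
  simp only [translation, add_right_inj, mul_eq_mul_left_iff, Int.cast_inj, mul_eq_zero,
    OfNat.ofNat_ne_zero, pi_ne_zero, or_self, or_false] at e1 e2
  exact hst (Prod.ext e1 e2)

theorem isTiling : IsTiling
    (fun t : ℤ × ℤ => translation t.1 t.2 '' closure (basin (F a) (π, π))) := by
  have hcl : ∀ t : ℤ × ℤ, translation t.1 t.2 '' closure (basin (F a) (π, π)) =
      closure (translation t.1 t.2 '' basin (F a) (π, π)) := fun t =>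
    (translationHomeo t.1 t.2).image_closure _
  have hop : ∀ t : ℤ × ℤ, IsOpen (translation t.1 t.2 '' basin (F a) (π, π)) := fun t =>
    (translationHomeo t.1 t.2).isOpen_image.2 (isOpen_basin_F h)
  simp only [IsTiling, hcl]
  refine ⟨fun t => ⟨isClosed_closure, ?_⟩, ?_, fun s t hst =>
    disjoint_interior_closure (hop t) (disjoint_translates hst)⟩
  · exact ((isSimplyConnected_basin_F h).nonempty.image _).mono
      (interior_maximal subset_closure (hop t))
  · simpa only [hcl] using iUnion_translates h

end

/-! ### The fixed points on the boundary -/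

lemma isSaddleIn_midV (ha0 : 0 < a) (ha1 : a < 1 / 6) (i : Fin 2) :
    IsSaddleIn (F a) (closure (basin (F a) (π, π))) (midV i) := by
  have h := admissible ha0 ha1
  refine ⟨frontier_subset_closure (midV_mem_frontier h i), ?_, exists_stable_midV h i,
    exists_unstable_midV h i⟩
  have hi : i = 0 ∨ i = 1 := by omega
  rcases hi with rfl | rfl <;> exact isSaddle_of_cos ha0 ha1 (by simp [midV]) (by simp [midV])
    (by simp [midV]) (by simp [midV])

lemma isSaddleIn_midH (ha0 : 0 < a) (ha1 : a < 1 / 6) (j : Fin 2) :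
    IsSaddleIn (F a) (closure (basin (F a) (π, π))) (midH j) := by
  have h := admissible ha0 ha1
  have e : (midV j).swap = midH j := rfl
  have hcl : ∀ {z}, z ∈ closure (basin (F a) (π, π)) →
      Prod.swap z ∈ closure (basin (F a) (π, π)) :=
    map_mem_closure_basin continuous_swap (semiconj_swap_F a) rfl
  refine ⟨frontier_subset_closure (midH_mem_frontier h j), ?_, ?_, ?_⟩
  · have hj : j = 0 ∨ j = 1 := by omega
    rcases hj with rfl | rfl <;> exact isSaddle_of_cos ha0 ha1 (by simp [midH]) (by simp [midH])
      (by simp [midH]) (by simp [midH])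
  · obtain ⟨z, hz, hne, hb⟩ := exists_stable_midV h j
    exact ⟨z.swap, hcl hz, e ▸ Prod.swap_injective.ne hne,
      e ▸ map_mem_basin continuous_swap (semiconj_swap_F a) hb⟩
  · obtain ⟨z, hz, hne, hb⟩ := exists_unstable_midV h j
    exact ⟨z.swap, hcl hz, e ▸ Prod.swap_injective.ne hne,
      e ▸ map_mem_unstableSet continuous_swap (semiconj_swap_F a) hb⟩

lemma isRepeller_corner (ha0 : 0 < a) (i j : Fin 2) : IsRepeller (F a) (corner i j) := by
  have hi : i = 0 ∨ i = 1 := by omega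
  have hj : j = 0 ∨ j = 1 := by omega
  rcases hi with rfl | rfl <;> rcases hj with rfl | rfl <;>
    exact isRepeller_of_cos ha0 (by simp [corner]) (by simp [corner]) (by simp [corner])
      (by simp [corner])

end AlignedClocks

end

open AlignedClocks in
theorem mainTheorem1 (a : ℝ) (ha0 : 0 < a) (ha1 : a < 1 / 6) :
    AlignedClocks.IsSink (AlignedClocks.F a) (Real.pi, Real.pi) ∧
    ∃ A : Set (ℝ × ℝ),
      -- `A` is the basin of attraction of the sink; it is bounded, open and simply connected
      A = AlignedClocks.basin (AlignedClocks.F a) (Real.pi, Real.pi) ∧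
      (Real.pi, Real.pi) ∈ A ∧
      IsOpen A ∧ Bornology.IsBounded A ∧ IsSimplyConnected A ∧
      -- repellers and saddles on the boundary
      (∀ i j : Fin 2, AlignedClocks.corner i j ∈ frontier A ∧
        AlignedClocks.IsRepellerIn (AlignedClocks.F a) (closure A) (AlignedClocks.corner i j)) ∧
      (∀ j : Fin 2, AlignedClocks.midH j ∈ frontier A ∧
        AlignedClocks.IsSaddleIn (AlignedClocks.F a) (closure A) (AlignedClocks.midH j)) ∧
      (∀ i : Fin 2, AlignedClocks.midV i ∈ frontier A ∧
        AlignedClocks.IsSaddleIn (AlignedClocks.F a) (closure A) (AlignedClocks.midV i)) ∧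
      -- the boundary consists of these eight points and eight heteroclinic curves, one from each
      -- repeller to each of the two adjacent saddles
      (∃ H V : Fin 2 → Fin 2 → Set (ℝ × ℝ),
        (∀ i j : Fin 2, AlignedClocks.IsHeteroclinicCurve (AlignedClocks.F a)
          (AlignedClocks.corner i j) (AlignedClocks.midH j) (H i j)) ∧
        (∀ i j : Fin 2, AlignedClocks.IsHeteroclinicCurve (AlignedClocks.F a)
          (AlignedClocks.corner i j) (AlignedClocks.midV i) (V i j)) ∧
        frontier A =
          (⋃ i : Fin 2, ⋃ j : Fin 2, ({AlignedClocks.corner i j} ∪ H i j ∪ V i j)) ∪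
            Set.range AlignedClocks.midH ∪ Set.range AlignedClocks.midV) ∧
      -- strong invariance of the boundary
      AlignedClocks.F a '' frontier A = frontier A ∧
      -- the translates of the closure tile the plane, with the same dynamics on each tile
      AlignedClocks.IsTiling
        (fun t : ℤ × ℤ => AlignedClocks.translation t.1 t.2 '' closure A) ∧
      (∀ l k : ℤ,
        Function.Semiconj (AlignedClocks.translation l k) (AlignedClocks.F a)
          (AlignedClocks.F a) ∧
        AlignedClocks.F a '' (AlignedClocks.translation l k '' closure A) =
          AlignedClocks.translation l k '' closure A) := by
  have h := admissible ha0 ha1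
  refine ⟨isSink_of_cos ha0 ha1 (by simp) (by simp) (by simp) (by simp),
    basin (F a) (Real.pi, Real.pi), rfl,
    mem_basin_of_fixed (F_eq_self (by simp) (by simp)), isOpen_basin_F h, isBounded_basin_F h,
    isSimplyConnected_basin_F h, fun i j => ⟨corner_mem_frontier h i j,
      frontier_subset_closure (corner_mem_frontier h i j), isRepeller_corner ha0 i j⟩,
    fun j => ⟨midH_mem_frontier h j, isSaddleIn_midH ha0 ha1 j⟩,
    fun i => ⟨midV_mem_frontier h i, isSaddleIn_midV ha0 ha1 i⟩,
    ⟨fun i j => Prod.swap '' vertical h j i, vertical h, isHeteroclinicCurve_horizontal h,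
      isHeteroclinicCurve_vertical h, frontier_eq h⟩,
    image_frontier_basin_F h _, isTiling h, fun l k => ⟨semiconj_translation a l k, ?_⟩⟩
  rw [← Set.image_comp, ← (semiconj_translation a l k).comp_eq, Set.image_comp,
    image_closure_basin_F h]
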